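/- Let $\mathbb{K}$ be a field. A simplicial complex $\Delta$ on a vertex set $V$ is a set of finite subsets of $V$ (its faces) closed under passing to subsets; $\emptyset$ counts as a face. For $\sigma\in\Delta$ put $\operatorname{link}_\Delta\sigma=\{\tau\in\Delta:\sigma\cap\tau=\emptyset,\ \sigma\cup\tau\in\Delta\}$, and let $\widetilde H_i$ denote reduced simplicial homology with coefficients in $\mathbb{K}$ (so $\widetilde H_{-1}(\{\emptyset\})\neq 0$). The complex $\Delta$ is called PR (over $\mathbb{K}$) if for every $i$ and all $\sigma,\tau\in\Delta$ with $\widetilde H_i(\operatorname{link}_\Delta\sigma)\ne 0\neq\widetilde H_i(\operatorname{link}_\Delta\tau)$ one has $|\sigma|=|\tau|$. If $\Delta$ is PR, let $p$ be the largest integer such that $\widetilde H_{p-1}(\operatorname{link}_\Delta\sigma)\neq 0$ for some $\sigma\in\Delta$, for $0\le i\le p$ let $s_i$ be the size of the faces $\sigma$ of $\Delta$ with $\widetilde H_{i-1}(\operatorname{link}_\Delta\sigma)\ne0$, and put $d_i=s_{i-1}-s_i$ for $1\le i\le p$; the sequence $(d_p,\dots,d_1)$ is the degree type of $\Delta$.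 Let $a,p,m$ be integers with $a\ge 2$ and $1\le m\le p$. Let $V_p^a$ be the set of vertices $x_i$ ($0\le i\le p$) and $y_i^j$ ($0\le i\le p$, $1\le j\le a-1$), on which the symmetric group of $\{0,\dots,p\}$ acts by $g(x_i)=x_{g(i)}$, $g(y_i^j)=y_{g(i)}^j$. For $1\le i\le m$ and a partition $\lambda=(\lambda_1\ge\dots\ge\lambda_i>0)$ of $a+i-2$ into $i$ parts, put $$G_{p,i}^\lambda=\{x_i,\dots,x_p\}\sqcup\{y_r^j: 0\le r\le i-1,\ 1\le j\le\lambda_{r+1}\}.$$ The partition complex $\mathcal{P}(a,p,m)$ is the smallest simplicial complex on $V_p^a$ containing all the sets $gG_{p,i}^\lambda$, where $1\le i\le m$, $\lambda$ is a partition of $a+i-2$ into $i$ parts, and $g$ is a permutation of $\{0,\dots,p\}$. Theorem. The partition complex $\mathcal{P}(a,p,m)$ is PR over $\mathbb{K}$, and its degree type is the sequence $(1,\dots,1,a,1,\dots,1)$ of length $p$ whose entry $a$ is in position $m$ counted from the right; that is, $d_m=a$ and $d_i=1$ for all $1\le i\le p$ with $i\neq m$. -/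

import Mathlib

open scoped Pointwise

noncomputable section

/-! ### Simplicial complexes that may contain the empty face -/

/-- A simplicial complex on the vertex set `V`: a set of finite subsets of `V` closed under passing
to subsets. The empty set is allowed as a face, so that the void complex (no faces) and the
irrelevant complex `{∅}` are different. -/
@[ext]
structure FaceComplex (V : Type*) where
  faces : Set (Finset V)
  down_closed : ∀ {F G : Finset V}, F ∈ faces → G ⊆ F → G ∈ faces

/-- The quotient `Z / (Z ∩ B)` of two submodules of a module; it is `Z / B` when `B ≤ Z`. -/
abbrev Subquotient {R M : Type*} [Ring R] [AddCommGroup M] [Module R M] (Z B : Submodule R M) :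
    Type _ :=
  Z ⧸ B.submoduleOf Z

lemma nontrivial_subquotient_iff {R M : Type*} [Ring R] [AddCommGroup M] [Module R M]
    (Z B : Submodule R M) : Nontrivial (Subquotient Z B) ↔ ∃ z ∈ Z, z ∉ B := by
  rw [Submodule.Quotient.nontrivial_iff]
  simp [Submodule.submoduleOf, Submodule.eq_top_iff']

namespace FaceComplex

variable {V : Type*}

/-- The smallest simplicial complex that contains all members of `S`. -/
def generate (S : Set (Finset V)) : FaceComplex V where
  faces := {G | ∃ F ∈ S, G ⊆ F}
  down_closed := by
    rintro F G ⟨E, hE, hFE⟩ hGF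
    exact ⟨E, hE, hGF.trans hFE⟩

/-- The complex generated by all the translates `g • F` with `g` in the group `Γ` and `F ∈ S`. -/
def generateOrbit (Γ : Type*) [Group Γ] [MulAction Γ V] [DecidableEq V] (S : Set (Finset V)) :
    FaceComplex V :=
  generate {H | ∃ g : Γ, ∃ F ∈ S, H = g • F}

/-- The link of `f` in `Δ`: the faces of `Δ` disjoint from `f` whose union with `f` is a face. -/
def link [DecidableEq V] (Δ : FaceComplex V) (f : Finset V) : FaceComplex V where
  faces := {σ | σ ∈ Δ.faces ∧ Disjoint f σ ∧ f ∪ σ ∈ Δ.faces}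
  down_closed := by
    rintro F G ⟨hF, hd, hu⟩ hGF
    exact ⟨Δ.down_closed hF hGF, hd.mono_right hGF,
      Δ.down_closed hu (Finset.union_subset_union_right hGF)⟩

/-! ### Reduced simplicial homology -/

section Homology

variable (K : Type*) [Field K] [LinearOrder V]

/-- The sign of the vertex `v` in the face `σ`: `(-1) ^ r`, where `r` is the number of
vertices of `σ` that precede `v`. -/
def faceSign (σ : Finset V) (v : V) : K :=
  (-1) ^ (σ.filter (· < v)).card

/-- The boundary map on formal linear combinations of finite sets of vertices,
`∂ σ = ∑ v ∈ σ, ± (σ \ {v})`. -/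
def boundaryMap : (Finset V →₀ K) →ₗ[K] (Finset V →₀ K) :=
  Finsupp.linearCombination K
    (fun σ : Finset V => ∑ v ∈ σ, Finsupp.single (σ.erase v) (faceSign K σ v))

lemma boundaryMap_single (σ : Finset V) (c : K) :
    boundaryMap K (Finsupp.single σ c) =
      c • ∑ v ∈ σ, Finsupp.single (σ.erase v) (faceSign K σ v) := by
  simp [boundaryMap]

lemma faceSign_erase_of_lt {σ : Finset V} {v w : V} (h : v < w) :
    faceSign K (σ.erase w) v = faceSign K σ v := by
  unfold faceSign
  congr 2
  ext u
  simp only [Finset.mem_filter, Finset.mem_erase]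
  constructor
  · rintro ⟨⟨_, h1⟩, h2⟩
    exact ⟨h1, h2⟩
  · rintro ⟨h1, h2⟩
    exact ⟨⟨(h2.trans h).ne, h1⟩, h2⟩

lemma faceSign_erase_of_gt {σ : Finset V} {v w : V} (hv : v ∈ σ) (h : v < w) :
    faceSign K (σ.erase v) w = - faceSign K σ w := by
  unfold faceSign
  have h1 : (σ.erase v).filter (· < w) = (σ.filter (· < w)).erase v := by
    ext u
    simp only [Finset.mem_filter, Finset.mem_erase]
    tauto
  have h2 : v ∈ σ.filter (· < w) := by simp [hv, h]
  rw [h1, ← Finset.card_erase_add_one h2, pow_succ]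
  ring

/-- `∂ ∘ ∂ = 0`. -/
lemma boundaryMap_boundaryMap (c : Finset V →₀ K) : boundaryMap K (boundaryMap K c) = 0 := by
  induction c using Finsupp.induction_linear with
  | zero => simp
  | add f g hf hg => simp [hf, hg]
  | single σ c =>
    rw [boundaryMap_single, map_smul, map_sum]
    simp only [boundaryMap_single, Finset.smul_sum]
    rw [Finset.sum_sigma']
    refine Finset.sum_involution (fun q _ => ⟨q.2, q.1⟩) ?_ ?_ ?_ ?_
    · rintro ⟨v, w⟩ hq
      simp only [Finset.mem_sigma, Finset.mem_erase] at hq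
      obtain ⟨hv, hwv, hw⟩ := hq
      simp only [Finset.erase_right_comm (a := w) (b := v), Finsupp.smul_single, smul_eq_mul]
      rw [← Finsupp.single_add, ← mul_add]
      rcases lt_or_gt_of_ne hwv with h | h
      · rw [faceSign_erase_of_lt K h, faceSign_erase_of_gt K hw h]
        simp [mul_comm]
      · rw [faceSign_erase_of_lt K h, faceSign_erase_of_gt K hv h]
        simp [mul_comm]
    · rintro ⟨v, w⟩ hq _ heq
      simp only [Finset.mem_sigma, Finset.mem_erase] at hq
      simp only [Sigma.mk.injEq, heq_eq_eq] at heq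
      exact hq.2.1 heq.1
    · rintro ⟨v, w⟩ hq
      simp only [Finset.mem_sigma, Finset.mem_erase] at hq ⊢
      exact ⟨hq.2.2, hq.2.1.symm, hq.1⟩
    · rintro ⟨v, w⟩ _
      rfl

variable (Δ : FaceComplex V) (i : ℤ)

/-- The reduced `i`-chains of `Δ`: the formal `K`-linear combinations of the faces of dimension `i`,
that is, with `i + 1` vertices. In degree `-1` they are spanned by the empty face. -/
def chains : Submodule K (Finset V →₀ K) :=
  Finsupp.supported K K {σ | σ ∈ Δ.faces ∧ (σ.card : ℤ) = i + 1}

/-- The reduced `i`-cycles of `Δ`. -/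
def cycles : Submodule K (Finset V →₀ K) :=
  Δ.chains K i ⊓ LinearMap.ker (boundaryMap K)

/-- The reduced `i`-boundaries of `Δ`. -/
def boundaries : Submodule K (Finset V →₀ K) :=
  (Δ.chains K (i + 1)).map (boundaryMap K)

lemma boundaries_le_cycles : Δ.boundaries K i ≤ Δ.cycles K i := by
  rintro _ ⟨c, hc, rfl⟩
  refine ⟨?_, boundaryMap_boundaryMap K c⟩
  simp only [boundaryMap, Finsupp.linearCombination_apply]
  refine Submodule.sum_mem _ fun σ hσ => Submodule.smul_mem _ _ (Submodule.sum_mem _ fun v hv => ?_)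
  obtain ⟨h1, h2⟩ := hc hσ
  refine Finsupp.single_mem_supported K _ ⟨Δ.down_closed h1 (Finset.erase_subset v σ), ?_⟩
  have := Finset.card_erase_add_one hv
  omega

/-- The reduced simplicial homology `H̃_i(Δ; K)`, for every integer `i`. -/
abbrev ReducedHomology : Type _ :=
  Subquotient (Δ.cycles K i) (Δ.boundaries K i)

lemma nontrivial_reducedHomology_iff :
    Nontrivial (Δ.ReducedHomology K i) ↔ ∃ z ∈ Δ.cycles K i, z ∉ Δ.boundaries K i :=
  nontrivial_subquotient_iff _ _

/-! ### PR complexes and their degree types -/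

/-- `Δ` has a face with `n` vertices whose link has nonzero reduced homology in degree `i`. -/
def HasLinkHomology (n : ℕ) : Prop :=
  ∃ σ ∈ Δ.faces, σ.card = n ∧ Nontrivial ((Δ.link σ).ReducedHomology K i)

/-- `Δ` is a PR complex over `K`: two faces whose links both have nonzero reduced homology in the
same degree have the same number of vertices. -/
def IsPR : Prop :=
  ∀ i : ℤ, ∀ σ ∈ Δ.faces, ∀ τ ∈ Δ.faces,
    Nontrivial ((Δ.link σ).ReducedHomology K i) →
    Nontrivial ((Δ.link τ).ReducedHomology K i) → σ.card = τ.card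

/-- `Δ` is a PR complex over `K` with degree type `d = (d_p, …, d_1)` (so that `d_i` is the entry in
position `p - i`, counted from `0`, of the list `d` of length `p`): the largest `k` such that some
link in `Δ` has nonzero reduced homology in degree `k - 1` is `p`; and, if `s_i` (`0 ≤ i ≤ p`)
denotes the number of vertices of the faces whose links have nonzero reduced homology in
degree `i - 1`, then `d_i = s_{i-1} - s_i` for `1 ≤ i ≤ p`. -/
def HasDegreeType (d : List ℕ) : Prop :=
  Δ.IsPR K ∧
  IsGreatest {k : ℤ | ∃ n, Δ.HasLinkHomology K (k - 1) n} d.length ∧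
  ∃ s : ℕ → ℕ,
    (∀ i : ℕ, i ≤ d.length → Δ.HasLinkHomology K ((i : ℤ) - 1) (s i)) ∧
    ∀ (i : ℕ) (_ : 1 ≤ i) (_ : i ≤ d.length),
      ((d[d.length - i] : ℕ) : ℤ) = (s (i - 1) : ℤ) - (s i : ℤ)

end Homology

end FaceComplex

/-! ### Partition complexes -/

/-- The vertices `x_i` (`0 ≤ i ≤ p`) and `y_i^j` (`0 ≤ i ≤ p`, `1 ≤ j ≤ a - 1`);
`y i j` stands for `y_i^{j+1}`, as elements of `Fin` are counted from `0`. -/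
inductive PartitionVertex (a p : ℕ) : Type
  | x (i : Fin (p + 1)) : PartitionVertex a p
  | y (i : Fin (p + 1)) (j : Fin (a - 1)) : PartitionVertex a p

namespace PartitionVertex

variable {a p : ℕ}

/-- An injective key by which the vertices are ordered: `x_0, y_0^1, …, y_0^{a-1}, x_1, …`. -/
def key : PartitionVertex a p → ℕ ×ₗ ℕ
  | x i => toLex (i.val, 0)
  | y i j => toLex (i.val, j.val + 1)

lemma key_injective : Function.Injective (key : PartitionVertex a p → ℕ ×ₗ ℕ) := by
  rintro (i | ⟨i, j⟩) (k | ⟨k, l⟩) h <;> simp [key, Fin.ext_iff] at h ⊢ <;> exact h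

instance : LinearOrder (PartitionVertex a p) := LinearOrder.lift' key key_injective

/-- The symmetric group on `{0, …, p}` acts by `g x_i = x_{g i}` and `g y_i^j = y_{g i}^j`. -/
instance : MulAction (Equiv.Perm (Fin (p + 1))) (PartitionVertex a p) where
  smul g v := match v with
    | x i => x (g i)
    | y i j => y (g i) j
  one_smul v := by cases v <;> rfl
  mul_smul g h v := by cases v <;> rfl

end PartitionVertex

/-- The partitions `lam 0 ≥ lam 1 ≥ … ≥ lam (i - 1) > 0` of `a + i - 2` into `i` parts. -/
def partitionsInto (a i : ℕ) : Set (Fin i → ℕ) :=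
  {lam | Antitone lam ∧ (∀ r, 0 < lam r) ∧ ∑ r, lam r = a + i - 2}

/-- The generating set `{x_i, …, x_p} ∪ {y_r^j : 0 ≤ r ≤ i - 1, 1 ≤ j ≤ lam r}`. -/
def generatingSet (a p i : ℕ) (lam : Fin i → ℕ) : Finset (PartitionVertex a p) :=
  (Finset.univ.filter fun k : Fin (p + 1) => i ≤ k.val).image PartitionVertex.x ∪
  (Finset.univ.filter fun q : Fin (p + 1) × Fin (a - 1) =>
    ∃ h : q.1.val < i, q.2.val + 1 ≤ lam ⟨q.1.val, h⟩).image fun q => PartitionVertex.y q.1 q.2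

/-- The partition complex `P(a, p, m)`, for `a ≥ 2` and `1 ≤ m ≤ p + 1`. -/
def partitionComplex (a p m : ℕ) : FaceComplex (PartitionVertex a p) :=
  FaceComplex.generateOrbit (Equiv.Perm (Fin (p + 1)))
    {F | ∃ i : ℕ, 1 ≤ i ∧ i ≤ m ∧ ∃ lam ∈ partitionsInto a i, F = generatingSet a p i lam}

end

namespace FaceComplex

/-! ### The cone operator as a contracting homotopy -/

section Cone

variable (K : Type*) [Field K] {V : Type*} [LinearOrder V]

/-! View the vertices as rows, row `r` holding `x r` and all `y r j`. Let the height of a row in `F`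
be the largest 0-based `j` with `y r j ∈ F` (or 0), and let the cost be the sum of the heights.
Since a partition of `a + i - 2` into `i` parts has `∑ (λ_r - 1) = a - 2`, the faces are the sets in
which no row has both its `x` and some `y`, at most `m` rows have a `y`, the cost is at most `a -
2`, and some `x r` is missing (`mem_partitionComplex`). Dropping the last condition gives the
extended complex, whose links are easier.

Fix a face `σ` and let `f` be the number of its free rows (those without a vertex of `σ`). If some
`y` is missing below the top of its row, the link is a cone. Otherwise `|σ| + f = p + 1 + cost σ`
(`card_add_card_freeIndices`), and there are two cases.

If `σ` has no `y`, the link is acyclic for `f ≤ m`. For `f > m` it is an acyclic complex minus one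
facet, the set of the remaining `x r`, so its homology sits exactly in degree `f - 2`. Hence `|σ| +
j = p - 1` with `j ≥ m - 1`.

If `σ` has `y`s in `k > 0` rows, put `e = a - 2 - cost σ`. Removing dominated vertices leaves a core
that behaves like an `f`-fold suspension of the `(e-1)`-skeleton of a simplex on `k` vertices, with
everything vanishing if `k + f > m`. So nonzero homology forces `j = f + e - 1`, `e < k` and `k + f
≤ m`, whence `|σ| + j = p + a - 2` with `j ≤ m - 2` (`acyclicAt_core`,
`acyclicAt_extended_of_isInitial`).

The two cases occupy disjoint ranges of degrees and each determines `|σ|` from `j`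
(`card_of_nontrivial_reducedHomology_link`), which gives PR. Explicit faces realize every degree
(`hasLinkHomology_of_le`, `hasLinkHomology_of_lt`), and the jump `a` occurs where the ranges meet.
-/

lemma faceSign_mul_self (σ : Finset V) (v : V) : faceSign K σ v * faceSign K σ v = 1 := by
  unfold faceSign
  rw [← pow_add, ← two_mul, pow_mul]
  simp

/-- The cone operator with apex `v`: it sends a face `σ` not containing `v` to `± (σ ∪ {v})`, and
a face containing `v` to `0`. -/
noncomputable def coneMap (v : V) : (Finset V →₀ K) →ₗ[K] (Finset V →₀ K) :=
  Finsupp.linearCombination K fun σ : Finset V =>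
    if v ∈ σ then 0 else Finsupp.single (insert v σ) (faceSign K (insert v σ) v)

lemma coneMap_single_of_mem {v : V} {σ : Finset V} (h : v ∈ σ) (c : K) :
    coneMap K v (Finsupp.single σ c) = 0 := by
  simp [coneMap, h]

lemma coneMap_single_of_notMem {v : V} {σ : Finset V} (h : v ∉ σ) (c : K) :
    coneMap K v (Finsupp.single σ c) =
      Finsupp.single (insert v σ) (c * faceSign K (insert v σ) v) := by
  simp [coneMap, h]

/-- Adding `v` and deleting `w` anticommute; this cancels the cross terms in the homotopy identity.
-/
lemma faceSign_mul_faceSign_insert {σ : Finset V} {v w : V} (hv : v ∉ σ) (hw : w ∈ σ) :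
    faceSign K (insert v σ) v * faceSign K (insert v σ) w +
      faceSign K σ w * faceSign K ((insert v σ).erase w) v = 0 := by
  have hvw : v ≠ w := fun h => hv (h ▸ hw)
  have he : (insert v σ).erase v = σ := Finset.erase_insert hv
  rcases lt_or_gt_of_ne hvw with h | h
  · have h1 := faceSign_erase_of_gt K (Finset.mem_insert_self v σ) h
    rw [he] at h1
    rw [faceSign_erase_of_lt K h, h1]
    ring
  · have h1 := faceSign_erase_of_lt K (σ := insert v σ) h
    rw [he] at h1
    rw [faceSign_erase_of_gt K (Finset.mem_insert_of_mem hw) h, h1]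
    ring

/-- The cone operator is a contracting homotopy of the full chain complex. -/
lemma boundaryMap_coneMap (v : V) (c : Finset V →₀ K) :
    boundaryMap K (coneMap K v c) + coneMap K v (boundaryMap K c) = c := by
  induction c using Finsupp.induction_linear with
  | zero => simp
  | add f g hf hg =>
    simp only [map_add]
    rw [add_add_add_comm, hf, hg]
  | single σ c =>
    by_cases h : v ∈ σ
    · rw [coneMap_single_of_mem K h, map_zero, zero_add, boundaryMap_single, map_smul, map_sum,
        Finset.sum_eq_single_of_mem v h]
      · rw [coneMap_single_of_notMem K (Finset.notMem_erase v σ), Finset.insert_erase h,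
          faceSign_mul_self, Finsupp.smul_single, smul_eq_mul, mul_one]
      · intro w _ hwv
        exact coneMap_single_of_mem K (Finset.mem_erase.2 ⟨hwv.symm, h⟩) _
    · rw [coneMap_single_of_notMem K h, boundaryMap_single, boundaryMap_single, map_smul, map_sum,
        Finset.sum_insert h, Finset.erase_insert h, smul_add, add_assoc]
      have h0 : ∑ w ∈ σ, Finsupp.single ((insert v σ).erase w) (faceSign K (insert v σ) w) =
          - (faceSign K (insert v σ) v) •
            ∑ w ∈ σ, coneMap K v (Finsupp.single (σ.erase w) (faceSign K σ w)) := by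
        rw [Finset.smul_sum]
        refine Finset.sum_congr rfl fun w hw => ?_
        have hvw : v ≠ w := fun e => h (e ▸ hw)
        rw [coneMap_single_of_notMem K (fun e => h (Finset.mem_of_mem_erase e)),
          ← Finset.erase_insert_of_ne hvw, Finsupp.smul_single]
        congr 1
        have h1 := faceSign_mul_faceSign_insert K h hw
        have h2 := faceSign_mul_self K (insert v σ) v
        rw [smul_eq_mul]
        linear_combination (-faceSign K (insert v σ) w) * h2 + faceSign K (insert v σ) v * h1
      rw [h0, smul_smul, Finsupp.smul_single, smul_eq_mul, mul_assoc, faceSign_mul_self, mul_one,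
        ← add_smul]
      have h2 := faceSign_mul_self K (insert v σ) v
      have : c * faceSign K (insert v σ) v * -faceSign K (insert v σ) v + c = 0 := by
        linear_combination (-c) * h2
      rw [this, zero_smul, add_zero]

lemma coneMap_mem_supported {v : V} {s t : Set (Finset V)} {c : Finset V →₀ K}
    (hc : c ∈ Finsupp.supported K K s) (h : ∀ σ ∈ s, v ∉ σ → insert v σ ∈ t) :
    coneMap K v c ∈ Finsupp.supported K K t := by
  rw [coneMap, Finsupp.linearCombination_apply]
  refine Submodule.sum_mem _ fun σ hσ => Submodule.smul_mem _ _ ?_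
  split_ifs with hv
  · exact Submodule.zero_mem _
  · exact Finsupp.single_mem_supported K _ (h σ (hc hσ) hv)

lemma boundaryMap_mem_supported {s t : Set (Finset V)} {c : Finset V →₀ K}
    (hc : c ∈ Finsupp.supported K K s) (h : ∀ σ ∈ s, ∀ v ∈ σ, σ.erase v ∈ t) :
    boundaryMap K c ∈ Finsupp.supported K K t := by
  rw [boundaryMap, Finsupp.linearCombination_apply]
  exact Submodule.sum_mem _ fun σ hσ => Submodule.smul_mem _ _ <| Submodule.sum_mem _ fun v hv =>
    Finsupp.single_mem_supported K _ (h σ (hc hσ) v hv)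

end Cone

lemma chains_mono {V K : Type*} [Field K] {Δ Γ : FaceComplex V} {i : ℤ}
    (h : ∀ σ ∈ Δ.faces, (σ.card : ℤ) = i + 1 → σ ∈ Γ.faces) : Δ.chains K i ≤ Γ.chains K i :=
  Finsupp.supported_mono fun σ hσ => ⟨h σ hσ.1 hσ.2, hσ.2⟩

/-! ### Vanishing criteria: cones, deletion and link, domination -/

section Acyclic

variable {V : Type*} [LinearOrder V]

/-- The faces of `link σ` that only use vertices from `S`, without the requirement that `S` be
disjoint from `σ`. -/
def linkWithin (Δ : FaceComplex V) (σ : Finset V) (S : Set V) : FaceComplex V where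
  faces := {τ | ↑τ ⊆ S ∧ σ ∪ τ ∈ Δ.faces}
  down_closed := by
    rintro F G ⟨hF, hu⟩ hGF
    exact ⟨(Finset.coe_subset.2 hGF).trans hF,
      Δ.down_closed hu (Finset.union_subset_union_right hGF)⟩

lemma mem_linkWithin {Δ : FaceComplex V} {σ τ : Finset V} {S : Set V} :
    τ ∈ (Δ.linkWithin σ S).faces ↔ ↑τ ⊆ S ∧ σ ∪ τ ∈ Δ.faces := Iff.rfl

lemma link_eq_linkWithin (Δ : FaceComplex V) (σ : Finset V) :
    Δ.link σ = Δ.linkWithin σ (↑σ)ᶜ := by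
  ext τ
  simp only [link, linkWithin, Set.mem_ofPred_eq, Set.subset_compl_iff_disjoint_left,
    Finset.disjoint_coe]
  exact ⟨fun h => h.2, fun h => ⟨Δ.down_closed h.2 Finset.subset_union_right, h⟩⟩

variable (K : Type*) [Field K]

/-- The reduced homology of `Δ` in degree `i` vanishes. -/
def AcyclicAt (Δ : FaceComplex V) (i : ℤ) : Prop := Δ.cycles K i ≤ Δ.boundaries K i

lemma nontrivial_reducedHomology_iff_not_acyclicAt {Δ : FaceComplex V} {i : ℤ} :
    Nontrivial (Δ.ReducedHomology K i) ↔ ¬ Δ.AcyclicAt K i := by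
  rw [nontrivial_reducedHomology_iff, AcyclicAt, SetLike.not_le_iff_exists]

variable {K}

/-- Homology vanishes in a degree without faces. -/
lemma acyclicAt_of_forall_card_ne {Δ : FaceComplex V} {i : ℤ}
    (h : ∀ σ ∈ Δ.faces, (σ.card : ℤ) ≠ i + 1) : Δ.AcyclicAt K i := by
  rintro z ⟨hz, -⟩
  have : z = 0 := by
    change z ∈ Finsupp.supported K K {σ | σ ∈ Δ.faces ∧ (σ.card : ℤ) = i + 1} at hz
    rw [Set.eq_empty_of_forall_notMem (s := {σ | σ ∈ Δ.faces ∧ (σ.card : ℤ) = i + 1})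
      fun σ hσ => h σ hσ.1 hσ.2, Finsupp.supported_empty] at hz
    exact hz
  rw [this]
  exact Submodule.zero_mem _

/-- A complex whose faces of dimension `i` can all be joined to a fixed vertex. -/
lemma acyclicAt_of_insert_mem {Δ : FaceComplex V} {i : ℤ} (v : V)
    (h : ∀ σ ∈ Δ.faces, (σ.card : ℤ) = i + 1 → insert v σ ∈ Δ.faces) : Δ.AcyclicAt K i := by
  rintro z ⟨hz, hz0⟩
  refine ⟨coneMap K v z, coneMap_mem_supported K hz ?_, ?_⟩
  · rintro σ ⟨h1, h2⟩ hv
    refine ⟨h σ h1 h2, ?_⟩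
    rw [Finset.card_insert_of_notMem hv]
    push_cast
    rw [h2]
  · have h1 := boundaryMap_coneMap K v z
    rwa [LinearMap.mem_ker.1 hz0, map_zero, add_zero] at h1

/-- Vanishing of homology from the deletion and the link of a vertex. -/
lemma acyclicAt_linkWithin_of_deletion {Δ : FaceComplex V} {σ : Finset V} {S : Set V} {i : ℤ}
    {v : V} (hv : v ∈ S) (hdel : (Δ.linkWithin σ (S \ {v})).AcyclicAt K i)
    (hlink : (Δ.linkWithin (insert v σ) (S \ {v})).AcyclicAt K (i - 1)) :
    (Δ.linkWithin σ S).AcyclicAt K i := by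
  rintro z ⟨hz, hz0⟩
  -- Mayer–Vietoris by hand: the boundary of the part of `z` through `v` is a cycle in the link of
  -- `v`. Filling it there by `w` moves that part into the deletion.
  set zv := z.filter (v ∈ ·) with hzv
  set z0 := z.filter (fun τ => ¬ v ∈ τ) with hzz
  have hsum : zv + z0 = z := Finsupp.filter_add_filter_not z _
  have hzvs : zv ∈ Finsupp.supported K K
      {τ | (τ ∈ (Δ.linkWithin σ S).faces ∧ (τ.card : ℤ) = i + 1) ∧ v ∈ τ} := by
    intro τ hτ
    rw [Finset.mem_coe, hzv, Finsupp.support_filter, Finset.mem_filter] at hτ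
    exact ⟨hz hτ.1, hτ.2⟩
  have hz0s : z0 ∈ Finsupp.supported K K
      {τ | (τ ∈ (Δ.linkWithin σ S).faces ∧ (τ.card : ℤ) = i + 1) ∧ v ∉ τ} := by
    intro τ hτ
    rw [Finset.mem_coe, hzz, Finsupp.support_filter, Finset.mem_filter] at hτ
    exact ⟨hz hτ.1, hτ.2⟩
  have hcone : coneMap K v (boundaryMap K zv) = zv := by
    have h1 := boundaryMap_coneMap K v zv
    have h2 : coneMap K v zv = 0 := by
      have : coneMap K v zv ∈ Finsupp.supported K K (∅ : Set (Finset V)) :=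
        coneMap_mem_supported K hzvs fun τ hτ h => h hτ.2
      rwa [Finsupp.supported_empty] at this
    rwa [h2, map_zero, zero_add] at h1
  have hneg : boundaryMap K zv = - boundaryMap K z0 := by
    have h1 : boundaryMap K z = 0 := hz0
    rw [← hsum, map_add] at h1
    exact eq_neg_of_add_eq_zero_left h1
  have hu : boundaryMap K zv ∈ (Δ.linkWithin (insert v σ) (S \ {v})).cycles K (i - 1) := by
    refine ⟨?_, boundaryMap_boundaryMap K zv⟩
    -- Terms of `∂ zv` that still contain `v` cancel, because `∂ zv = -∂ z0`; the surviving terms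
    -- come from erasing `v`.
    have h1 : boundaryMap K zv ∈ Finsupp.supported K K {τ : Finset V | v ∉ τ} := by
      rw [hneg]
      exact Submodule.neg_mem _ (boundaryMap_mem_supported K hz0s fun τ hτ w _ hw =>
        hτ.2 (Finset.mem_of_mem_erase hw))
    have h2 : boundaryMap K zv ∈ Finsupp.supported K K
        {τ : Finset V | v ∉ τ → τ ∈ (Δ.linkWithin (insert v σ) (S \ {v})).faces ∧
          (τ.card : ℤ) = i - 1 + 1} := by
      refine boundaryMap_mem_supported K hzvs ?_
      rintro τ ⟨⟨⟨hτS, hτΔ⟩, hcard⟩, hvτ⟩ w hw hvw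
      have hwv : v = w := by
        by_contra hne
        exact hvw (Finset.mem_erase.2 ⟨hne, hvτ⟩)
      subst hwv
      refine ⟨⟨?_, ?_⟩, ?_⟩
      · intro u hu
        have := Finset.mem_erase.1 (Finset.mem_coe.1 hu)
        exact ⟨hτS this.2, this.1⟩
      · rwa [Finset.insert_union, ← Finset.union_insert, Finset.insert_erase hvτ]
      · have := Finset.card_erase_add_one hvτ
        omega
    exact fun τ hτ => h2 hτ (h1 hτ)
  obtain ⟨w, hw, hwu⟩ := hlink hu
  rw [sub_add_cancel] at hw
  have hwd : w ∈ (Δ.linkWithin σ (S \ {v})).chains K i :=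
    (chains_mono (Γ := Δ.linkWithin σ (S \ {v})) fun τ hτ _ => ⟨hτ.1, Δ.down_closed hτ.2
      (Finset.union_subset_union_left (Finset.subset_insert v σ))⟩ :
        (Δ.linkWithin (insert v σ) (S \ {v})).chains K i ≤ _) hw
  have hbd : boundaryMap K (coneMap K v w) = w - zv := by
    have h1 := boundaryMap_coneMap K v w
    rw [hwu, hcone] at h1
    exact eq_sub_of_add_eq h1
  have hcyc : z0 + w ∈ (Δ.linkWithin σ (S \ {v})).cycles K i := by
    refine ⟨Submodule.add_mem _ ?_ hwd, ?_⟩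
    · refine Finsupp.supported_mono ?_ hz0s
      rintro τ ⟨⟨⟨hτS, hτΔ⟩, hcard⟩, hvτ⟩
      refine ⟨⟨fun u hu' => ⟨hτS hu', ?_⟩, hτΔ⟩, hcard⟩
      rintro rfl
      exact hvτ hu'
    · change boundaryMap K (z0 + w) = 0
      rw [map_add, hwu, hneg, add_neg_cancel]
  obtain ⟨b, hb, hbz⟩ := hdel hcyc
  -- `∂ b = z0 + w` and `∂ (coneMap K v w) = w - zv`, so the difference bounds `z0 + zv = z`.
  refine ⟨b - coneMap K v w, Submodule.sub_mem _ ?_ ?_, ?_⟩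
  · exact (chains_mono fun τ hτ _ => ⟨hτ.1.trans Set.sdiff_subset, hτ.2⟩ :
      (Δ.linkWithin σ (S \ {v})).chains K (i + 1) ≤ (Δ.linkWithin σ S).chains K (i + 1)) hb
  · refine coneMap_mem_supported K hw ?_
    rintro τ ⟨⟨hτS, hτΔ⟩, hcard⟩ hvτ
    refine ⟨⟨?_, ?_⟩, ?_⟩
    · rw [Finset.coe_insert]
      exact Set.insert_subset hv (hτS.trans Set.sdiff_subset)
    · rwa [Finset.union_insert, ← Finset.insert_union]
    · rw [Finset.card_insert_of_notMem hvτ]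
      push_cast
      rw [hcard]
  · rw [map_sub, hbz, hbd, ← hsum]
    abel

lemma acyclicAt_linkWithin_of_notMem {Δ : FaceComplex V} {σ : Finset V} {S : Set V} {i : ℤ}
    (h : σ ∉ Δ.faces) : (Δ.linkWithin σ S).AcyclicAt K i :=
  acyclicAt_of_forall_card_ne fun _ hτ => (h (Δ.down_closed hτ.2 Finset.subset_union_left)).elim

/-- Vertices that are dominated by other vertices of `S`, or are no vertices of the link, can be
removed. -/
lemma acyclicAt_linkWithin_of_dominated {Δ : FaceComplex V} {σ : Finset V} {S : Set V} {i : ℤ}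
    (T : Finset V) (hTS : ↑T ⊆ S)
    (hT : ∀ v ∈ T, insert v σ ∈ Δ.faces → ∃ w ∈ S, w ∉ T ∧
      ∀ τ ∈ Δ.faces, v ∈ τ → σ ⊆ τ → insert w τ ∈ Δ.faces)
    (h : (Δ.linkWithin σ (S \ ↑T)).AcyclicAt K i) : (Δ.linkWithin σ S).AcyclicAt K i := by
  induction T using Finset.induction_on generalizing S with
  | empty => simpa using h
  | insert v T hvT ih =>
    have hvS : v ∈ S := hTS (by simp)
    refine acyclicAt_linkWithin_of_deletion hvS (ih ?_ ?_ ?_) ?_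
    · intro w hw
      refine ⟨hTS (by simp [Finset.mem_coe.1 hw]), ?_⟩
      rintro rfl
      exact hvT hw
    · intro u hu hface
      obtain ⟨w, hwS, hwT, hw⟩ := hT u (Finset.mem_insert_of_mem hu) hface
      simp only [Finset.mem_insert, not_or] at hwT
      exact ⟨w, ⟨hwS, hwT.1⟩, hwT.2, hw⟩
    · rwa [Finset.coe_insert, ← Set.singleton_union, ← Set.sdiff_sdiff] at h
    · by_cases hface : insert v σ ∈ Δ.faces
      · obtain ⟨w, hwS, hwT, hw⟩ := hT v (Finset.mem_insert_self v T) hface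
        simp only [Finset.mem_insert, not_or] at hwT
        -- The link of `v` is a cone with apex `w`; being outside the whole removed set, `w` is
        -- still available.
        refine acyclicAt_of_insert_mem w fun τ hτ _ => ⟨?_, ?_⟩
        · rw [Finset.coe_insert]
          exact Set.insert_subset ⟨hwS, hwT.1⟩ hτ.1
        · rw [Finset.union_insert]
          exact hw _ hτ.2 (by simp)
            ((Finset.subset_insert v σ).trans Finset.subset_union_left)
      · exact acyclicAt_linkWithin_of_notMem hface

end Acyclic

end FaceComplex

/-! ### Rows, heights and cost -/

namespace PartitionVertex

variable {a p : ℕ}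

instance : Finite (PartitionVertex a p) := by
  refine Finite.of_surjective (α := Fin (p + 1) ⊕ (Fin (p + 1) × Fin (a - 1)))
    (Sum.elim x fun q => y q.1 q.2) ?_
  rintro (i | ⟨i, j⟩)
  · exact ⟨Sum.inl i, rfl⟩
  · exact ⟨Sum.inr (i, j), rfl⟩

lemma smul_x (g : Equiv.Perm (Fin (p + 1))) (i : Fin (p + 1)) :
    g • (x i : PartitionVertex a p) = x (g i) := rfl

lemma smul_y (g : Equiv.Perm (Fin (p + 1))) (i : Fin (p + 1)) (j : Fin (a - 1)) :
    g • (y i j : PartitionVertex a p) = y (g i) j := rfl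

/-- The indices `r` such that some `y r j` belongs to `F`. -/
def ySupport (F : Finset (PartitionVertex a p)) : Finset (Fin (p + 1)) :=
  Finset.univ.filter fun r => ∃ j, y r j ∈ F

/-- The largest `j` with `y r j ∈ F`, and `0` if there is none. -/
def yHeight (F : Finset (PartitionVertex a p)) (r : Fin (p + 1)) : ℕ :=
  (Finset.univ.filter fun j => y r j ∈ F).sup Fin.val

/-- The sum of the heights of `F` over all indices. -/
def cost (F : Finset (PartitionVertex a p)) : ℕ := ∑ r, yHeight F r

lemma mem_ySupport {F : Finset (PartitionVertex a p)} {r : Fin (p + 1)} :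
    r ∈ ySupport F ↔ ∃ j, y r j ∈ F := by
  simp [ySupport]

lemma mem_ySupport_of_mem {F : Finset (PartitionVertex a p)} {r : Fin (p + 1)} {j : Fin (a - 1)}
    (h : y r j ∈ F) : r ∈ ySupport F := mem_ySupport.2 ⟨j, h⟩

lemma le_yHeight {F : Finset (PartitionVertex a p)} {r : Fin (p + 1)} {j : Fin (a - 1)}
    (h : y r j ∈ F) : j.val ≤ yHeight F r :=
  Finset.le_sup (f := Fin.val) (by simpa using h)

lemma yHeight_le {F : Finset (PartitionVertex a p)} {r : Fin (p + 1)} {n : ℕ}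
    (h : ∀ j, y r j ∈ F → j.val ≤ n) : yHeight F r ≤ n :=
  Finset.sup_le fun j hj => h j (by simpa using hj)

lemma yHeight_eq_zero {F : Finset (PartitionVertex a p)} {r : Fin (p + 1)}
    (h : r ∉ ySupport F) : yHeight F r = 0 :=
  Nat.le_zero.1 (yHeight_le fun _ hj => (h (mem_ySupport_of_mem hj)).elim)

lemma ySupport_mono {F G : Finset (PartitionVertex a p)} (h : F ⊆ G) : ySupport F ⊆ ySupport G :=
  fun r hr => by
    obtain ⟨j, hj⟩ := mem_ySupport.1 hr
    exact mem_ySupport_of_mem (h hj)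

lemma yHeight_mono {F G : Finset (PartitionVertex a p)} (h : F ⊆ G) (r : Fin (p + 1)) :
    yHeight F r ≤ yHeight G r :=
  yHeight_le fun _ hj => le_yHeight (h hj)

lemma cost_mono {F G : Finset (PartitionVertex a p)} (h : F ⊆ G) : cost F ≤ cost G :=
  Finset.sum_le_sum fun r _ => yHeight_mono h r

lemma ySupport_insert_x (F : Finset (PartitionVertex a p)) (i : Fin (p + 1)) :
    ySupport (insert (x i) F) = ySupport F := by
  ext r
  simp [mem_ySupport]

lemma yHeight_insert_x (F : Finset (PartitionVertex a p)) (i r : Fin (p + 1)) :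
    yHeight (insert (x i) F) r = yHeight F r := by
  simp [yHeight]

lemma cost_insert_x (F : Finset (PartitionVertex a p)) (i : Fin (p + 1)) :
    cost (insert (x i) F) = cost F := by
  simp [cost, yHeight_insert_x]

lemma ySupport_insert_y (F : Finset (PartitionVertex a p)) (i : Fin (p + 1)) (j : Fin (a - 1)) :
    ySupport (insert (y i j) F) = insert i (ySupport F) := by
  ext r
  simp only [mem_ySupport, Finset.mem_insert, y.injEq]
  constructor
  · rintro ⟨k, ⟨rfl, -⟩ | hk⟩
    · exact Or.inl rfl
    · exact Or.inr ⟨k, hk⟩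
  · rintro (rfl | ⟨k, hk⟩)
    · exact ⟨j, Or.inl ⟨rfl, rfl⟩⟩
    · exact ⟨k, Or.inr hk⟩

lemma yHeight_insert_y_of_ne (F : Finset (PartitionVertex a p)) {i r : Fin (p + 1)}
    (j : Fin (a - 1)) (h : r ≠ i) : yHeight (insert (y i j) F) r = yHeight F r := by
  simp [yHeight, h]

lemma yHeight_insert_y (F : Finset (PartitionVertex a p)) (i : Fin (p + 1)) (j : Fin (a - 1)) :
    yHeight (insert (y i j) F) i = max (yHeight F i) j.val := by
  apply le_antisymm
  · refine yHeight_le fun k hk => ?_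
    rcases Finset.mem_insert.1 hk with h | h
    · rw [y.injEq] at h
      rw [h.2]
      exact le_max_right _ _
    · exact (le_yHeight h).trans (le_max_left _ _)
  · exact max_le (yHeight_mono (Finset.subset_insert _ _) i)
      (le_yHeight (Finset.mem_insert_self _ _))

/-- Applies also to an empty row with `j = 0`: the default height makes the first `y` of a row free
of charge. -/
lemma cost_insert_y_of_le (F : Finset (PartitionVertex a p)) {i : Fin (p + 1)} {j : Fin (a - 1)}
    (h : j.val ≤ yHeight F i) : cost (insert (y i j) F) = cost F := by
  refine Finset.sum_congr rfl fun r _ => ?_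
  rcases eq_or_ne r i with rfl | hr
  · rw [yHeight_insert_y, max_eq_left h]
  · exact yHeight_insert_y_of_ne F j hr

end PartitionVertex

open PartitionVertex FaceComplex

/-- The complex that differs from the partition complex only in that the faces may contain all
the vertices `x_0, …, x_p`. -/
def extendedPartitionComplex (a p m : ℕ) : FaceComplex (PartitionVertex a p) where
  faces := {F | (∀ r, x r ∈ F → r ∉ ySupport F) ∧ (ySupport F).card ≤ m ∧ cost F ≤ a - 2}
  down_closed := by
    rintro F G ⟨h1, h2, h3⟩ hGF
    exact ⟨fun r hr hr' => h1 r (hGF hr) (ySupport_mono hGF hr'),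
      (Finset.card_le_card (ySupport_mono hGF)).trans h2, (cost_mono hGF).trans h3⟩

/-! ### Description of the faces by support and cost -/

section Faces

variable {a p m : ℕ}

lemma x_mem_generatingSet {i : ℕ} {lam : Fin i → ℕ} {r : Fin (p + 1)} :
    x r ∈ generatingSet a p i lam ↔ i ≤ r.val := by
  simp [generatingSet]

lemma y_mem_generatingSet {i : ℕ} {lam : Fin i → ℕ} {r : Fin (p + 1)} {j : Fin (a - 1)} :
    y r j ∈ generatingSet a p i lam ↔ ∃ h : r.val < i, j.val + 1 ≤ lam ⟨r.val, h⟩ := by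
  simp [generatingSet]

lemma mem_extended_of_subset_smul_generatingSet {i : ℕ} {lam : Fin i → ℕ}
    {F : Finset (PartitionVertex a p)} {g : Equiv.Perm (Fin (p + 1))} (hi : i ≤ m)
    (hmp : m ≤ p) (hlam : lam ∈ partitionsInto a i) (hF : F ⊆ g • generatingSet a p i lam) :
    F ∈ (extendedPartitionComplex a p m).faces := by
  have hx : ∀ r, x r ∈ F → i ≤ (g⁻¹ r).val := fun r hr => by
    have := Finset.inv_smul_mem_iff.2 (hF hr)
    rwa [smul_x, x_mem_generatingSet] at this
  have hy : ∀ r j, y r j ∈ F → ∃ h : (g⁻¹ r).val < i, j.val + 1 ≤ lam ⟨(g⁻¹ r).val, h⟩ :=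
    fun r j hr => by
      have := Finset.inv_smul_mem_iff.2 (hF hr)
      rwa [smul_y, y_mem_generatingSet] at this
  obtain ⟨-, hpos, hsum⟩ := hlam
  refine ⟨fun r hr hr' => ?_, ?_, ?_⟩
  · obtain ⟨j, hj⟩ := mem_ySupport.1 hr'
    obtain ⟨h, -⟩ := hy r j hj
    exact absurd (hx r hr) (not_le.2 h)
  · refine le_trans ?_ hi
    rw [← Finset.card_range i]
    refine Finset.card_le_card_of_injOn (fun r => (g⁻¹ r).val) ?_ ?_
    · intro r hr
      obtain ⟨j, hj⟩ := mem_ySupport.1 hr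
      obtain ⟨h, -⟩ := hy r j hj
      simpa using h
    · intro r _ s _ h
      exact g⁻¹.injective (Fin.ext h)
  -- A part `λ_r` allows height at most `λ_r - 1`, and these bounds add up to `(a + i - 2) - i = a -
  -- 2`.
  · have hle : ∀ r, yHeight F r ≤
        (fun q : Fin (p + 1) => if h : q.val < i then lam ⟨q.val, h⟩ - 1 else 0) (g⁻¹ r) := by
      intro r
      refine yHeight_le fun j hj => ?_
      obtain ⟨h, h'⟩ := hy r j hj
      simp only [h, dite_true]
      omega
    refine (Finset.sum_le_sum fun r _ => hle r).trans ?_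
    rw [Equiv.sum_comp g⁻¹
      (fun q : Fin (p + 1) => if h : q.val < i then lam ⟨q.val, h⟩ - 1 else 0)]
    have h1 : (∑ q : Fin (p + 1), if h : q.val < i then lam ⟨q.val, h⟩ - 1 else 0) =
        ∑ q : Fin i, (lam q - 1) := by
      rw [Fin.sum_univ_eq_sum_range (fun q => if h : q < i then lam ⟨q, h⟩ - 1 else 0) (p + 1),
        ← Finset.sum_subset (Finset.range_mono (show i ≤ p + 1 by omega)) fun q _ hq => by
          rw [dif_neg (by simpa using hq)], Finset.sum_range]
      exact Finset.sum_congr rfl fun q _ => by simp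
    have h2 : ∑ q : Fin i, (lam q - 1 + 1) = ∑ q, lam q :=
      Finset.sum_congr rfl fun q _ => Nat.sub_add_cancel (hpos q)
    rw [Finset.sum_add_distrib, Finset.sum_const, Finset.card_univ, Fintype.card_fin,
      smul_eq_mul] at h2
    omega

/-- Every assignment of positive numbers with sum `a + |Y| - 2` to an index set `Y` comes from a
translate of a generating set. -/
lemma exists_smul_generatingSet (Y : Finset (Fin (p + 1))) (f : Fin (p + 1) → ℕ)
    (hf : ∀ r ∈ Y, 0 < f r) (hsum : ∑ r ∈ Y, f r = a + Y.card - 2) :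
    ∃ g : Equiv.Perm (Fin (p + 1)), ∃ lam ∈ partitionsInto a Y.card,
      (∀ r, x r ∈ g • generatingSet a p Y.card lam ↔ r ∉ Y) ∧
      ∀ r j, y r j ∈ g • generatingSet a p Y.card lam ↔ r ∈ Y ∧ j.val + 1 ≤ f r := by
  set i := Y.card with hi
  have hip : i ≤ p + 1 := by simpa using Y.card_le_univ
  let e : Fin i ≃ Y := Y.equivFin.symm
  let s : Equiv.Perm (Fin i) := Tuple.sort fun q => OrderDual.toDual (f (e q))
  let e' : Fin i ≃ Y := s.trans e
  let c : {q : Fin (p + 1) // q.val < i} ≃ {r // r ∈ Y} :=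
    { toFun := fun q => e' ⟨q.1.val, q.2⟩
      invFun := fun r => ⟨⟨(e'.symm r).val, (e'.symm r).2.trans_le hip⟩, (e'.symm r).2⟩
      left_inv := fun q => by simp
      right_inv := fun r => by simp }
  let g : Equiv.Perm (Fin (p + 1)) := c.extendSubtype
  have hg : ∀ q : Fin (p + 1), q.val < i ↔ g q ∈ Y := fun q => by
    constructor
    · exact fun h => c.extendSubtype_mem q h
    · exact fun h => by_contra fun hq => c.extendSubtype_not_mem q hq h
  have hgv : ∀ (q : Fin (p + 1)) (h : q.val < i), g q = e' ⟨q.val, h⟩ := fun q h =>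
    c.extendSubtype_apply_of_mem q h
  have hg' : ∀ r, (g⁻¹ r).val < i ↔ r ∈ Y := fun r => by
    rw [hg]
    simp
  refine ⟨g, fun q => f (e' q), ⟨?_, fun q => hf _ (e' q).2, ?_⟩, fun r => ?_, fun r j => ?_⟩
  · intro q q' hqq
    exact Tuple.monotone_sort (fun q => OrderDual.toDual (f (e q))) hqq
  · rw [← hsum, ← Finset.sum_coe_sort Y f]
    exact Equiv.sum_comp e' fun r : Y => f r
  · rw [← Finset.inv_smul_mem_iff, smul_x, x_mem_generatingSet, ← not_lt, hg']
  · rw [← Finset.inv_smul_mem_iff, smul_y, y_mem_generatingSet]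
    have key : ∀ h : (g⁻¹ r).val < i, (e' ⟨(g⁻¹ r).val, h⟩ : Fin (p + 1)) = r := fun h => by
      rw [← hgv _ h]
      simp
    constructor
    · rintro ⟨h, h'⟩
      rw [key h] at h'
      exact ⟨(hg' r).1 h, h'⟩
    · rintro ⟨h, h'⟩
      exact ⟨(hg' r).2 h, by rwa [key]⟩

lemma mem_partitionComplex (ha : 2 ≤ a) (hm : 1 ≤ m) (hmp : m ≤ p)
    {F : Finset (PartitionVertex a p)} :
    F ∈ (partitionComplex a p m).faces ↔
      F ∈ (extendedPartitionComplex a p m).faces ∧ ∃ r, x r ∉ F := by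
  constructor
  · rintro ⟨_, ⟨g, _, ⟨i, hi, him, lam, hlam, rfl⟩, rfl⟩, hF⟩
    -- Since `i ≥ 1`, the vertex `x 0` lies in no generating set.
    refine ⟨mem_extended_of_subset_smul_generatingSet him hmp hlam hF, g 0, fun h => ?_⟩
    have := Finset.inv_smul_mem_iff.2 (hF h)
    rw [smul_x, x_mem_generatingSet] at this
    simp at this
    omega
  · rintro ⟨⟨h1, h2, h3⟩, r0, hr0⟩
    -- A partition needs at least one part. If `F` has no `y`, the row of a missing `x` serves; this
    -- is where the extra condition enters.
    obtain ⟨Y, hYne, hYF, hYm, hYx⟩ : ∃ Y : Finset (Fin (p + 1)), Y.Nonempty ∧ ySupport F ⊆ Y ∧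
        Y.card ≤ m ∧ ∀ r, x r ∈ F → r ∉ Y := by
      rcases (ySupport F).eq_empty_or_nonempty with h | h
      · refine ⟨{r0}, by simp, by simp [h], by simpa using hm, fun r hr hr' => ?_⟩
        rw [Finset.mem_singleton] at hr'
        exact hr0 (hr' ▸ hr)
      · exact ⟨ySupport F, h, subset_rfl, h2, h1⟩
    obtain ⟨r1, hr1⟩ := hYne
    have hc : ∑ r ∈ Y, yHeight F r = cost F :=
      Finset.sum_subset (Finset.subset_univ Y) fun r _ hr =>
        yHeight_eq_zero fun h => hr (hYF h)
    have hYpos : 0 < Y.card := Finset.card_pos.2 ⟨r1, hr1⟩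
    -- The parts are the heights plus one, with the unused budget `a - 2 - cost F` added to the
    -- single row `r1`.
    obtain ⟨g, lam, hlam, hgx, hgy⟩ := exists_smul_generatingSet (a := a) Y
      (fun r => yHeight F r + 1 + if r = r1 then a - 2 - cost F else 0) (fun r _ => by omega) (by
        rw [Finset.sum_add_distrib, Finset.sum_add_distrib, hc, Finset.sum_ite_eq' Y r1,
          if_pos hr1, Finset.sum_const, smul_eq_mul]
        omega)
    refine ⟨_, ⟨g, _, ⟨Y.card, hYpos, hYm, lam, hlam, rfl⟩, rfl⟩, fun v hv => ?_⟩
    cases v with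
    | x r => exact (hgx r).2 (hYx r hv)
    | y r j =>
      refine (hgy r j).2 ⟨hYF (mem_ySupport_of_mem hv), ?_⟩
      have := le_yHeight hv
      omega

end Faces

/-! ### Free rows, initial faces and the core of a link -/

namespace PartitionVertex

variable {a p : ℕ}

/-- The index of a vertex. -/
def idx : PartitionVertex a p → Fin (p + 1)
  | x r => r
  | y r _ => r

@[simp] lemma idx_x (r : Fin (p + 1)) : idx (x r : PartitionVertex a p) = r := rfl

@[simp] lemma idx_y (r : Fin (p + 1)) (j : Fin (a - 1)) :
    idx (y r j : PartitionVertex a p) = r := rfl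

lemma yHeight_lt {F : Finset (PartitionVertex a p)} (ha : 2 ≤ a) (r : Fin (p + 1)) :
    yHeight F r < a - 1 :=
  (yHeight_le (n := a - 2) fun j _ => by omega).trans_lt (by omega)

lemma yHeight_le_cost (F : Finset (PartitionVertex a p)) (r : Fin (p + 1)) :
    yHeight F r ≤ cost F :=
  Finset.single_le_sum (f := yHeight F) (fun _ _ => Nat.zero_le _) (Finset.mem_univ r)

lemma cost_insert_y_of_eq_succ (F : Finset (PartitionVertex a p)) {i : Fin (p + 1)}
    {j : Fin (a - 1)} (h : j.val = yHeight F i + 1) :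
    cost (insert (y i j) F) = cost F + 1 := by
  unfold cost
  rw [← Finset.add_sum_erase _ _ (Finset.mem_univ i),
    ← Finset.add_sum_erase _ (yHeight F) (Finset.mem_univ i), yHeight_insert_y, h,
    max_eq_right (Nat.le_succ _), Finset.sum_congr rfl fun r hr =>
      yHeight_insert_y_of_ne F j (Finset.ne_of_mem_erase hr)]
  omega

lemma ySupport_union (F G : Finset (PartitionVertex a p)) :
    ySupport (F ∪ G) = ySupport F ∪ ySupport G := by
  ext r
  simp [mem_ySupport, exists_or]

/-- The indices that no vertex of `F` has. -/
def freeIndices (F : Finset (PartitionVertex a p)) : Finset (Fin (p + 1)) :=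
  Finset.univ.filter fun r => r ∉ ySupport F ∧ x r ∉ F

lemma mem_freeIndices {F : Finset (PartitionVertex a p)} {r : Fin (p + 1)} :
    r ∈ freeIndices F ↔ r ∉ ySupport F ∧ x r ∉ F := by
  simp [freeIndices]

/-- `F` contains `y r j` whenever it contains some `y r k` with `j ≤ k`. -/
def IsInitial (F : Finset (PartitionVertex a p)) : Prop :=
  ∀ r ∈ ySupport F, ∀ j : Fin (a - 1), j.val ≤ yHeight F r → y r j ∈ F

/-- Count by rows: a free row and a row with its `x` both contribute 1, and by initiality a row with
`y`s contributes its height plus one. -/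
lemma card_add_card_freeIndices (ha : 2 ≤ a) {F : Finset (PartitionVertex a p)}
    (hx : ∀ r, x r ∈ F → r ∉ ySupport F) (hF : IsInitial F) :
    F.card + (freeIndices F).card = p + 1 + cost F := by
  rw [Finset.card_eq_sum_card_fiberwise (f := idx) (t := Finset.univ) (fun _ _ => by simp),
    freeIndices, Finset.card_filter, ← Finset.sum_add_distrib]
  have hp : p + 1 + cost F = ∑ r : Fin (p + 1), (1 + yHeight F r) := by
    rw [Finset.sum_add_distrib, cost]
    simp
  rw [hp]
  refine Finset.sum_congr rfl fun r _ => ?_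
  by_cases hr : r ∈ ySupport F
  · have hxr : x r ∉ F := fun h => hx r h hr
    have h1 : F.filter (fun v => idx v = r) =
        (Finset.Iic (⟨yHeight F r, yHeight_lt ha r⟩ : Fin (a - 1))).image (y r) := by
      ext v
      simp only [Finset.mem_filter, Finset.mem_image, Finset.mem_Iic, Fin.le_def]
      constructor
      · rintro ⟨hv, hvr⟩
        cases v with
        | x s =>
          rw [idx_x] at hvr
          exact (hxr (hvr ▸ hv)).elim
        | y s j =>
          rw [idx_y] at hvr
          subst hvr
          exact ⟨j, le_yHeight hv, rfl⟩
      · rintro ⟨j, hj, rfl⟩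
        exact ⟨hF r hr j hj, rfl⟩
    rw [h1, Finset.card_image_of_injective _ (fun j k h => (y.inj h).2), Fin.card_Iic]
    simp [hr]
    omega
  · have hy : ∀ j, y r j ∉ F := fun j hj => hr (mem_ySupport_of_mem hj)
    have h1 : F.filter (fun v => idx v = r) = if x r ∈ F then {x r} else ∅ := by
      ext v
      simp only [Finset.mem_filter]
      constructor
      · rintro ⟨hv, hvr⟩
        cases v with
        | x s =>
          rw [idx_x] at hvr
          subst hvr
          simp [hv]
        | y s j =>
          rw [idx_y] at hvr
          exact (hy j (hvr ▸ hv)).elim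
      · split_ifs with h
        · intro hv
          rw [Finset.mem_singleton] at hv
          subst hv
          exact ⟨h, rfl⟩
        · simp
    rw [h1, yHeight_eq_zero hr]
    by_cases h : x r ∈ F <;> simp [h, hr]

/-- The vertices `x r`, `y r 0` for `r ∈ Z`, and those which increase the height of `F` by one at
some `r ∈ W`. -/
def coreVertices (F : Finset (PartitionVertex a p)) (Z W : Finset (Fin (p + 1))) :
    Set (PartitionVertex a p) :=
  {v | match v with
    | x r => r ∈ Z
    | y r j => (r ∈ Z ∧ j.val = 0) ∨ (r ∈ W ∧ j.val = yHeight F r + 1)}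

lemma x_mem_coreVertices {F : Finset (PartitionVertex a p)} {Z W : Finset (Fin (p + 1))}
    {r : Fin (p + 1)} : x r ∈ coreVertices F Z W ↔ r ∈ Z := Iff.rfl

lemma y_mem_coreVertices {F : Finset (PartitionVertex a p)} {Z W : Finset (Fin (p + 1))}
    {r : Fin (p + 1)} {j : Fin (a - 1)} : y r j ∈ coreVertices F Z W ↔
      (r ∈ Z ∧ j.val = 0) ∨ (r ∈ W ∧ j.val = yHeight F r + 1) := Iff.rfl

/-- A row of `W` has at most one core vertex, and it raises that row by one. Thus the cost bound
becomes a bound on cardinality, which makes this core a skeleton of a simplex. -/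
lemma cost_union_of_subset_coreVertices {F τ : Finset (PartitionVertex a p)}
    {W : Finset (Fin (p + 1))} (hτ : ↑τ ⊆ coreVertices F ∅ W) :
    cost (F ∪ τ) = cost F + τ.card := by
  induction τ using Finset.induction_on with
  | empty => simp
  | insert v τ hv ih =>
    rw [Finset.coe_insert, Set.insert_subset_iff] at hτ
    rw [Finset.union_insert, Finset.card_insert_of_notMem hv, ← add_assoc, ← ih hτ.2]
    cases v with
    | x r => simpa [x_mem_coreVertices] using hτ.1
    | y r j =>
      have hj : j.val = yHeight F r + 1 := by simpa [y_mem_coreVertices] using (hτ.1.resolve_left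
        (by simp)).2
      apply cost_insert_y_of_eq_succ
      rw [hj, le_antisymm (yHeight_le fun k hk => ?_) (yHeight_mono Finset.subset_union_left r)]
      rcases Finset.mem_union.1 hk with h | h
      · exact le_yHeight h
      · have hk' := (y_mem_coreVertices.1 (hτ.2 h)).resolve_left (by simp)
        have : k = j := Fin.ext (by omega)
        exact (hv (this ▸ h)).elim

lemma card_le_of_subset_coreVertices {F τ : Finset (PartitionVertex a p)}
    {W : Finset (Fin (p + 1))} (hτ : ↑τ ⊆ coreVertices F ∅ W) : τ.card ≤ W.card := by
  refine Finset.card_le_card_of_injOn idx ?_ ?_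
  · intro v hv
    have h := hτ hv
    cases v with
    | x r => simp [x_mem_coreVertices] at h
    | y r j => exact ((y_mem_coreVertices.1 h).resolve_left (by simp)).1
  · intro v hv w hw hvw
    have h := hτ hv
    have h' := hτ hw
    cases v with
    | x r => simp [x_mem_coreVertices] at h
    | y r j =>
      cases w with
      | x s => simp [x_mem_coreVertices] at h'
      | y s k =>
        rw [idx_y, idx_y] at hvw
        subst hvw
        have h1 := (y_mem_coreVertices.1 h).resolve_left (by simp)
        have h2 := (y_mem_coreVertices.1 h').resolve_left (by simp)
        rw [Fin.ext (h1.2.trans h2.2.symm)]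

lemma ySupport_subset_of_subset_coreVertices {F τ : Finset (PartitionVertex a p)}
    {W : Finset (Fin (p + 1))} (hτ : ↑τ ⊆ coreVertices F ∅ W) : ySupport τ ⊆ W := by
  intro r hr
  obtain ⟨_, hj⟩ := mem_ySupport.1 hr
  exact ((y_mem_coreVertices.1 (hτ hj)).resolve_left (by simp)).1

/-- The inductive step of `acyclicAt_core`: `z` stops being free but does not join `W`, which is why
`W` is kept separate from the support. -/
lemma coreVertices_insert_y {F : Finset (PartitionVertex a p)} {Z W : Finset (Fin (p + 1))}
    {z : Fin (p + 1)} {j : Fin (a - 1)} (hj : j.val = 0) (hzW : z ∉ W) :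
    (coreVertices F Z W \ {y z j}) \ {x z} =
      coreVertices (insert (y z j) F) (Z.erase z) W := by
  ext v
  cases v with
  | x r => simp [x_mem_coreVertices, and_comm]
  | y r k =>
    simp only [Set.mem_sdiff, Set.mem_singleton_iff, y_mem_coreVertices, y.injEq,
      Finset.mem_erase, reduceCtorEq, not_false_eq_true, and_true]
    rcases eq_or_ne r z with rfl | hr
    · have : k = j ↔ k.val = 0 := by rw [Fin.ext_iff, hj]
      simp only [hzW, false_and, or_false, this, true_and, ne_eq, not_true_eq_false, iff_false]
      tauto
    · simp [yHeight_insert_y_of_ne F j hr, hr]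

end PartitionVertex

/-! ### Links in the extended complex -/

section Acyclicity

variable {a p m : ℕ} {K : Type*} [Field K]

lemma insert_y_mem_extended_of_le {F : Finset (PartitionVertex a p)} {r : Fin (p + 1)}
    {k : Fin (a - 1)} (hF : F ∈ (extendedPartitionComplex a p m).faces) (hr : r ∈ ySupport F)
    (hk : k.val ≤ yHeight F r) : insert (y r k) F ∈ (extendedPartitionComplex a p m).faces := by
  have h : ySupport (insert (y r k) F) = ySupport F := by
    rw [ySupport_insert_y, Finset.insert_eq_of_mem hr]
  refine ⟨fun s hs => ?_, ?_, ?_⟩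
  · rw [h]
    exact hF.1 s (by simpa using hs)
  · rw [h]
    exact hF.2.1
  · rw [cost_insert_y_of_le F hk]
    exact hF.2.2

lemma insert_x_mem_extended {F : Finset (PartitionVertex a p)} {r : Fin (p + 1)}
    (hF : F ∈ (extendedPartitionComplex a p m).faces) (hr : r ∉ ySupport F) :
    insert (x r) F ∈ (extendedPartitionComplex a p m).faces := by
  refine ⟨fun s hs => ?_, ?_, ?_⟩
  · rw [ySupport_insert_x]
    rcases Finset.mem_insert.1 hs with h | h
    · rw [x.injEq] at h
      rwa [h]
    · exact hF.1 s h
  · rw [ySupport_insert_x]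
    exact hF.2.1
  · rw [cost_insert_x]
    exact hF.2.2

/-- The core of a link without free indices is a skeleton of a simplex. -/
lemma acyclicAt_core_of_isEmpty {σ : Finset (PartitionVertex a p)} {W : Finset (Fin (p + 1))}
    {j : ℤ} (hσ : σ ∈ (extendedPartitionComplex a p m).faces) (hW : W ⊆ ySupport σ)
    (hne : W.Nonempty) (h : j ≠ ((a - 2 - cost σ : ℕ) : ℤ) - 1 ∨ W.card ≤ a - 2 - cost σ) :
    ((extendedPartitionComplex a p m).linkWithin σ (coreVertices σ ∅ W)).AcyclicAt K j := by
  have hcost := hσ.2.2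
  -- With no budget left only the empty face remains. With a positive budget any vertex serves as
  -- apex below the top dimension, and also in it when the skeleton is the full simplex.
  rcases Nat.eq_zero_or_pos (a - 2 - cost σ) with he | he
  · refine acyclicAt_of_forall_card_ne ?_
    rintro τ ⟨hτ, hface⟩ hcard
    have h1 := hface.2.2
    rw [cost_union_of_subset_coreVertices hτ] at h1
    have := hne.card_pos
    omega
  · obtain ⟨w, hw⟩ := hne
    have hw' : yHeight σ w + 1 < a - 1 := by
      have := yHeight_le_cost σ w
      omega
    refine acyclicAt_of_insert_mem (y w ⟨yHeight σ w + 1, hw'⟩) ?_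
    rintro τ ⟨hτ, hface⟩ hcard
    by_cases hwτ : y w ⟨yHeight σ w + 1, hw'⟩ ∈ τ
    · rw [Finset.insert_eq_of_mem hwτ]
      exact ⟨hτ, hface⟩
    have hsub : ↑(insert (y w ⟨yHeight σ w + 1, hw'⟩) τ) ⊆ coreVertices σ ∅ W := by
      rw [Finset.coe_insert]
      exact Set.insert_subset (Or.inr ⟨hw, rfl⟩) hτ
    have hc1 := hface.2.2
    rw [cost_union_of_subset_coreVertices hτ] at hc1
    have hc2 := card_le_of_subset_coreVertices hsub
    rw [Finset.card_insert_of_notMem hwτ] at hc2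
    have hs : ySupport (σ ∪ insert (y w ⟨yHeight σ w + 1, hw'⟩) τ) = ySupport σ := by
      rw [ySupport_union]
      exact Finset.union_eq_left.2 ((ySupport_subset_of_subset_coreVertices hsub).trans hW)
    refine ⟨hsub, fun r hr => ?_, ?_, ?_⟩
    · rw [hs]
      refine fun h' => hface.1 r (by simpa using hr) ?_
      rw [ySupport_union]
      exact Finset.mem_union_left _ h'
    · rw [hs]
      exact hσ.2.1
    · rw [cost_union_of_subset_coreVertices hsub, Finset.card_insert_of_notMem hwτ]
      omega

/-- Each free row acts as a suspension by its pair `x z`, `y z 0`: deleting `y z 0` leaves a cone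
over `x z`, and passing to its link consumes the row and lowers the degree by one. The cost and
`|ySupport σ| + |Z|` stay constant, so if the latter exceeds `m` the support bound fails before `Z`
is used up. -/
lemma acyclicAt_core (ha : 2 ≤ a) {σ : Finset (PartitionVertex a p)}
    {Z W : Finset (Fin (p + 1))} {j : ℤ} (hσ : σ ∈ (extendedPartitionComplex a p m).faces)
    (hZ : Z ⊆ freeIndices σ) (hW : W ⊆ ySupport σ)
    (h : m < (ySupport σ).card + Z.card ∨ W.Nonempty ∧
      (j ≠ (Z.card : ℤ) + (a - 2 - cost σ : ℕ) - 1 ∨ W.card ≤ a - 2 - cost σ)) :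
    ((extendedPartitionComplex a p m).linkWithin σ (coreVertices σ Z W)).AcyclicAt K j := by
  induction hn : Z.card generalizing Z σ j with
  | zero =>
    obtain rfl := Finset.card_eq_zero.1 hn
    have := hσ.2.1
    simp only [Finset.card_empty, Nat.cast_zero, zero_add, add_zero] at h
    obtain ⟨h1, h2⟩ := h.resolve_left (by omega)
    exact acyclicAt_core_of_isEmpty hσ hW h1 h2
  | succ n ih =>
    obtain ⟨z, hz⟩ : Z.Nonempty := Finset.card_pos.1 (by omega)
    obtain ⟨hzs, hzx⟩ := mem_freeIndices.1 (hZ hz)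
    have hzW : z ∉ W := fun h => hzs (hW h)
    let o : Fin (a - 1) := ⟨0, by omega⟩
    refine acyclicAt_linkWithin_of_deletion (v := y z o) (Or.inl ⟨hz, rfl⟩) ?_ ?_
    · refine acyclicAt_of_insert_mem (x z) ?_
      rintro τ ⟨hτ, hface⟩ -
      refine ⟨?_, ?_⟩
      · rw [Finset.coe_insert]
        exact Set.insert_subset ⟨hz, by simp⟩ hτ
      · rw [Finset.union_insert]
        refine insert_x_mem_extended hface ?_
        rw [ySupport_union, Finset.mem_union, not_or]
        refine ⟨hzs, fun h' => ?_⟩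
        obtain ⟨k, hk⟩ := mem_ySupport.1 h'
        obtain ⟨h1, h2⟩ := hτ hk
        rcases y_mem_coreVertices.1 h1 with h3 | h3
        · exact h2 (by rw [Set.mem_singleton_iff, y.injEq]; exact ⟨rfl, Fin.ext h3.2⟩)
        · exact hzW h3.1
    · by_cases hface : insert (y z o) σ ∈ (extendedPartitionComplex a p m).faces
      · refine acyclicAt_linkWithin_of_dominated {x z} ?_ ?_ ?_
        · rw [Finset.coe_singleton, Set.singleton_subset_iff]
          exact ⟨hz, by simp⟩
        · intro v hv hv'
          rw [Finset.mem_singleton] at hv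
          subst hv
          exact (hv'.1 z (by simp) (by simp [ySupport_insert_x, ySupport_insert_y])).elim
        · rw [Finset.coe_singleton, coreVertices_insert_y rfl hzW]
          have hcost : cost (insert (y z o) σ) = cost σ :=
            cost_insert_y_of_le σ (Nat.zero_le _)
          have hcard : (Z.erase z).card = n := by
            rw [Finset.card_erase_of_mem hz, hn, Nat.add_sub_cancel]
          refine ih hface ?_ ?_ ?_ hcard
          · intro r hr
            obtain ⟨hrz, hrZ⟩ := Finset.mem_erase.1 hr
            have := mem_freeIndices.1 (hZ hrZ)
            rw [mem_freeIndices, ySupport_insert_y]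
            simpa [hrz] using this
          · rw [ySupport_insert_y]
            exact hW.trans (Finset.subset_insert _ _)
          · rw [ySupport_insert_y, Finset.card_insert_of_notMem hzs, hcost, hcard]
            rw [hn] at h
            push_cast at h ⊢
            refine h.imp (fun h => by omega) (And.imp_right (Or.imp_left fun h h' => h ?_))
            omega
      · exact acyclicAt_linkWithin_of_notMem hface

/-- A vertex of the link outside the core is some `y r k`, dominated by the lowest `y` of its row
not in `σ`, since filling in below `y r k` changes neither support nor cost. -/
lemma acyclicAt_extended_of_isInitial (ha : 2 ≤ a) {σ : Finset (PartitionVertex a p)} {j : ℤ}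
    (hσ : σ ∈ (extendedPartitionComplex a p m).faces) (hinit : IsInitial σ)
    (h : m < (ySupport σ).card + (freeIndices σ).card ∨ (ySupport σ).Nonempty ∧
      (j ≠ ((freeIndices σ).card : ℤ) + (a - 2 - cost σ : ℕ) - 1 ∨
        (ySupport σ).card ≤ a - 2 - cost σ)) :
    ((extendedPartitionComplex a p m).linkWithin σ (↑σ)ᶜ).AcyclicAt K j := by
  set C := coreVertices σ (freeIndices σ) (ySupport σ) with hC
  have hCσ : C ⊆ (↑σ)ᶜ := by
    intro v hv hvσ
    cases v with
    | x r => exact (mem_freeIndices.1 (x_mem_coreVertices.1 hv)).2 hvσ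
    | y r k =>
      rcases y_mem_coreVertices.1 hv with h1 | h1
      · exact (mem_freeIndices.1 h1.1).1 (mem_ySupport_of_mem hvσ)
      · have := le_yHeight hvσ
        omega
  have hfin : ((↑σ : Set (PartitionVertex a p))ᶜ \ C).Finite := Set.toFinite _
  refine acyclicAt_linkWithin_of_dominated hfin.toFinset (by simp) ?_ ?_
  · intro v hv hface
    rw [Set.Finite.mem_toFinset] at hv
    obtain ⟨hvσ, hvC⟩ := hv
    cases v with
    | x r =>
      exfalso
      refine hvC (x_mem_coreVertices.2 (mem_freeIndices.2 ⟨?_, hvσ⟩))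
      have := hface.1 r (by simp)
      rwa [ySupport_insert_x] at this
    | y r k =>
      have key : ∀ l : Fin (a - 1), l.val ≤ k.val → y r l ∈ C →
          ∃ w ∈ (↑σ : Set (PartitionVertex a p))ᶜ, w ∉ hfin.toFinset ∧
          ∀ τ ∈ (extendedPartitionComplex a p m).faces, y r k ∈ τ → σ ⊆ τ →
            insert w τ ∈ (extendedPartitionComplex a p m).faces := by
        refine fun l hl hlC => ⟨y r l, hCσ hlC, by simp [hlC], fun τ hτ hk _ => ?_⟩
        exact insert_y_mem_extended_of_le hτ (mem_ySupport_of_mem hk)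
          (hl.trans (le_yHeight hk))
      by_cases hr : r ∈ ySupport σ
      · have hk : yHeight σ r < k.val := not_le.1 fun hle => hvσ (hinit r hr k hle)
        exact key ⟨yHeight σ r + 1, by omega⟩ hk (Or.inr ⟨hr, rfl⟩)
      · refine key ⟨0, by omega⟩ (Nat.zero_le _) (Or.inl ⟨mem_freeIndices.2 ⟨hr, fun hx => ?_⟩, rfl⟩)
        refine hface.1 r (by simp [hx]) ?_
        rw [ySupport_insert_y]
        exact Finset.mem_insert_self _ _
  · rw [Set.Finite.coe_toFinset, Set.sdiff_sdiff_cancel_left hCσ]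
    exact acyclicAt_core ha hσ subset_rfl subset_rfl h

end Acyclicity

/-! ### Upper bound: where links of the partition complex can have homology -/

section Vanishing

variable {a p m : ℕ} {K : Type*} [Field K]

lemma insert_y_mem_partitionComplex_of_le (ha : 2 ≤ a) (hm : 1 ≤ m) (hmp : m ≤ p)
    {F : Finset (PartitionVertex a p)} {r : Fin (p + 1)} {k : Fin (a - 1)}
    (hF : F ∈ (partitionComplex a p m).faces) (hr : r ∈ ySupport F)
    (hk : k.val ≤ yHeight F r) : insert (y r k) F ∈ (partitionComplex a p m).faces := by
  rw [mem_partitionComplex ha hm hmp] at hF ⊢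
  exact ⟨insert_y_mem_extended_of_le hF.1 hr hk, by simpa using hF.2⟩

/-- A `y` missing below the top of its row can be added to every face containing `σ`, so it is a
cone apex. -/
lemma acyclicAt_of_not_isInitial (ha : 2 ≤ a) (hm : 1 ≤ m) (hmp : m ≤ p)
    {σ : Finset (PartitionVertex a p)} {j : ℤ} (hinit : ¬ IsInitial σ) :
    ((partitionComplex a p m).linkWithin σ (↑σ)ᶜ).AcyclicAt K j := by
  simp only [IsInitial, not_forall] at hinit
  obtain ⟨r, hr, k, hk, hkσ⟩ := hinit
  refine acyclicAt_of_insert_mem (y r k) ?_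
  rintro τ ⟨hτ, hface⟩ -
  refine ⟨?_, ?_⟩
  · rw [Finset.coe_insert]
    exact Set.insert_subset hkσ hτ
  · rw [Finset.union_insert]
    exact insert_y_mem_partitionComplex_of_le ha hm hmp hface
      (ySupport_mono Finset.subset_union_left hr)
      (hk.trans (yHeight_mono Finset.subset_union_left r))

/-- A row with a `y` lacks its `x`, so the condition that some `x` be missing is automatic. -/
lemma linkWithin_partitionComplex_eq_extended (ha : 2 ≤ a) (hm : 1 ≤ m) (hmp : m ≤ p)
    {σ : Finset (PartitionVertex a p)} {S : Set (PartitionVertex a p)}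
    (hσ : (ySupport σ).Nonempty) :
    (partitionComplex a p m).linkWithin σ S = (extendedPartitionComplex a p m).linkWithin σ S := by
  obtain ⟨r, hr⟩ := hσ
  ext τ
  rw [mem_linkWithin, mem_linkWithin, mem_partitionComplex ha hm hmp]
  exact and_congr_right fun _ => and_iff_left_of_imp fun h =>
    ⟨r, fun hx => h.1 r hx (ySupport_mono Finset.subset_union_left hr)⟩

/-- Once `x z` is deleted, `y z 0` is a cone apex: it costs nothing, and the support stays within at
most `m` free rows. The link of `x z` has one free row fewer; with none left, `σ` contains every `x`
and is not a face. -/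
lemma acyclicAt_of_ySupport_eq_empty_of_card_le (ha : 2 ≤ a) (hm : 1 ≤ m) (hmp : m ≤ p)
    {σ : Finset (PartitionVertex a p)} {j : ℤ} (hσ : ySupport σ = ∅)
    (hn : (freeIndices σ).card ≤ m) :
    ((partitionComplex a p m).linkWithin σ (↑σ)ᶜ).AcyclicAt K j := by
  induction h : (freeIndices σ).card generalizing σ j with
  | zero =>
    refine acyclicAt_linkWithin_of_notMem fun hface => ?_
    obtain ⟨r, hr⟩ := ((mem_partitionComplex ha hm hmp).1 hface).2
    have : r ∈ freeIndices σ := mem_freeIndices.2 ⟨by simp [hσ], hr⟩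
    rw [Finset.card_eq_zero.1 h] at this
    simp at this
  | succ n ih =>
    obtain ⟨z, hz⟩ : (freeIndices σ).Nonempty := Finset.card_pos.1 (by omega)
    have hzx := (mem_freeIndices.1 hz).2
    have hfree : ∀ τ : Finset (PartitionVertex a p), σ ∪ τ ∈ (partitionComplex a p m).faces →
        ySupport (σ ∪ τ) ⊆ freeIndices σ := fun τ hτ r hr => by
      refine mem_freeIndices.2 ⟨by simp [hσ], fun hx => ?_⟩
      exact ((mem_partitionComplex ha hm hmp).1 hτ).1.1 r (Finset.mem_union_left _ hx) hr
    let o : Fin (a - 1) := ⟨0, by omega⟩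
    refine acyclicAt_linkWithin_of_deletion (v := x z) hzx ?_ ?_
    · refine acyclicAt_of_insert_mem (y z o) ?_
      rintro τ ⟨hτ, hface⟩ -
      have hyz : y z o ∉ σ := fun h => by
        have := mem_ySupport_of_mem h
        simp [hσ] at this
      have hxz : x z ∉ σ ∪ τ := by
        rw [Finset.mem_union, not_or]
        exact ⟨hzx, fun h => (hτ h).2 rfl⟩
      refine ⟨?_, ?_⟩
      · rw [Finset.coe_insert]
        exact Set.insert_subset ⟨hyz, by simp⟩ hτ
      · rw [Finset.union_insert]
        have hface' := (mem_partitionComplex ha hm hmp).1 hface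
        rw [mem_partitionComplex ha hm hmp]
        refine ⟨⟨fun r hr => ?_, ?_, ?_⟩, z, by simpa using hxz⟩
        · have hr' : x r ∈ σ ∪ τ := by simpa using hr
          rw [ySupport_insert_y, Finset.mem_insert, not_or]
          refine ⟨?_, hface'.1.1 r hr'⟩
          rintro rfl
          exact hxz hr'
        · rw [ySupport_insert_y]
          exact (Finset.card_le_card (Finset.insert_subset hz (hfree τ hface))).trans hn
        · rw [cost_insert_y_of_le _ (Nat.zero_le _)]
          exact hface'.1.2.2
    · have hS : ((↑σ : Set (PartitionVertex a p))ᶜ \ {x z}) = (↑(insert (x z) σ))ᶜ := by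
        ext v
        simp [and_comm]
      have hf : freeIndices (insert (x z) σ) = (freeIndices σ).erase z := by
        ext r
        simp only [mem_freeIndices, ySupport_insert_x, Finset.mem_insert, x.injEq,
          Finset.mem_erase]
        tauto
      have hc : ((freeIndices σ).erase z).card = n := by
        rw [Finset.card_erase_of_mem hz, h, Nat.add_sub_cancel]
      rw [hS]
      refine ih (by rw [ySupport_insert_x, hσ]) ?_ ?_
      · rw [hf, hc]
        omega
      · rw [hf, hc]

lemma isInitial_of_ySupport_eq_empty {σ : Finset (PartitionVertex a p)} (hσ : ySupport σ = ∅) :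
    IsInitial σ := fun r hr => by simp [hσ] at hr

/-- If `σ` consists of vertices `x r`, then only one face of its link in the extended complex contains
all the remaining vertices `x r`. -/
lemma eq_image_of_forall_x_mem {σ τ : Finset (PartitionVertex a p)} (hσ : ySupport σ = ∅)
    (hτσ : (↑τ : Set (PartitionVertex a p)) ⊆ (↑σ)ᶜ)
    (hτ : σ ∪ τ ∈ (extendedPartitionComplex a p m).faces)
    (hτ' : ∀ r ∈ freeIndices σ, x r ∈ τ) : τ = (freeIndices σ).image x := by
  ext v
  rw [Finset.mem_image]
  constructor
  · intro hv
    cases v with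
    | x r => exact ⟨r, mem_freeIndices.2 ⟨by simp [hσ], hτσ hv⟩, rfl⟩
    | y r j =>
      exfalso
      refine hτ.1 r ?_ (mem_ySupport_of_mem (Finset.mem_union_right _ hv))
      rw [Finset.mem_union]
      by_contra hr
      rw [not_or] at hr
      exact hr.2 (hτ' r (mem_freeIndices.2 ⟨by simp [hσ], hr.1⟩))
  · rintro ⟨r, hr, rfl⟩
    exact hτ' r hr

/-- Cycles bound in the extended link, which has just one additional face. That face can occur in a
filling only when `j + 1 = (freeIndices σ).card - 1`. -/
lemma acyclicAt_of_ySupport_eq_empty_of_lt (ha : 2 ≤ a) (hm : 1 ≤ m) (hmp : m ≤ p)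
    {σ : Finset (PartitionVertex a p)} {j : ℤ}
    (hσf : σ ∈ (partitionComplex a p m).faces) (hσ : ySupport σ = ∅)
    (hn : m < (freeIndices σ).card) (hj : j ≠ (freeIndices σ).card - 2) :
    ((partitionComplex a p m).linkWithin σ (↑σ)ᶜ).AcyclicAt K j := by
  have hσf' := ((mem_partitionComplex ha hm hmp).1 hσf).1
  rintro z ⟨hz, hz0⟩
  have hz' : z ∈ ((extendedPartitionComplex a p m).linkWithin σ (↑σ)ᶜ).chains K j :=
    (chains_mono fun τ hτ _ => ⟨hτ.1, ((mem_partitionComplex ha hm hmp).1 hτ.2).1⟩ :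
      ((partitionComplex a p m).linkWithin σ (↑σ)ᶜ).chains K j ≤
        ((extendedPartitionComplex a p m).linkWithin σ (↑σ)ᶜ).chains K j) hz
  obtain ⟨c, hc, hcz⟩ := acyclicAt_extended_of_isInitial (K := K) ha hσf'
    (isInitial_of_ySupport_eq_empty hσ) (Or.inl (by omega)) ⟨hz', hz0⟩
  refine ⟨c, ?_, hcz⟩
  refine (chains_mono fun τ hτ hcard => ⟨hτ.1, ?_⟩ :
      ((extendedPartitionComplex a p m).linkWithin σ (↑σ)ᶜ).chains K (j + 1) ≤
        ((partitionComplex a p m).linkWithin σ (↑σ)ᶜ).chains K (j + 1)) hc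
  rw [mem_partitionComplex ha hm hmp]
  refine ⟨hτ.2, ?_⟩
  by_contra! hall
  have := eq_image_of_forall_x_mem hσ hτ.1 hτ.2 fun r hr =>
    (Finset.mem_union.1 (hall r)).resolve_left (mem_freeIndices.1 hr).2
  rw [this, Finset.card_image_of_injective _ fun r s h => x.inj h] at hcard
  omega

lemma card_of_nontrivial_reducedHomology_link (ha : 2 ≤ a) (hm : 1 ≤ m) (hmp : m ≤ p)
    {σ : Finset (PartitionVertex a p)} {j : ℤ} (hσ : σ ∈ (partitionComplex a p m).faces)
    (h : Nontrivial (((partitionComplex a p m).link σ).ReducedHomology K j)) :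
    ((m : ℤ) - 1 ≤ j ∧ (σ.card : ℤ) + j = p - 1) ∨
      (j ≤ (m : ℤ) - 2 ∧ (σ.card : ℤ) + j = p + a - 2) := by
  rw [nontrivial_reducedHomology_iff_not_acyclicAt, link_eq_linkWithin] at h
  have hinit : IsInitial σ := by
    by_contra hinit
    exact h (acyclicAt_of_not_isInitial ha hm hmp hinit)
  have hσ' := ((mem_partitionComplex ha hm hmp).1 hσ).1
  have hcard := card_add_card_freeIndices ha hσ'.1 hinit
  have hcost := hσ'.2.2
  rcases (ySupport σ).eq_empty_or_nonempty with hy | hy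
  · left
    have hn : m < (freeIndices σ).card := by
      by_contra hn
      exact h (acyclicAt_of_ySupport_eq_empty_of_card_le ha hm hmp hy (not_lt.1 hn))
    have hj : j = (freeIndices σ).card - 2 := by
      by_contra hj
      exact h (acyclicAt_of_ySupport_eq_empty_of_lt ha hm hmp hσ hy hn hj)
    have hc0 : cost σ = 0 := Finset.sum_eq_zero fun r _ => yHeight_eq_zero (by simp [hy])
    omega
  · right
    rw [linkWithin_partitionComplex_eq_extended ha hm hmp hy] at h
    have h' := mt (acyclicAt_extended_of_isInitial (K := K) (j := j) ha hσ' hinit) h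
    push Not at h'
    obtain ⟨h1, h2⟩ := h'
    obtain ⟨h3, h4⟩ := h2 hy
    omega

end Vanishing

/-! ### Lower bound: links with homology in every degree -/

section Nonvanishing

variable {a p m : ℕ} (K : Type*) [Field K]

/-- The boundary of the missing simplex `X` survives. If `c` filled it, `X - c` would be a cycle in
the acyclic extended link, hence a boundary; but `X` is a facet there, so boundaries have
coefficient 0 at `X`. -/
lemma not_acyclicAt_of_ySupport_eq_empty (ha : 2 ≤ a) (hm : 1 ≤ m) (hmp : m ≤ p)
    {σ : Finset (PartitionVertex a p)} (hσf : σ ∈ (partitionComplex a p m).faces)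
    (hσ : ySupport σ = ∅) (hn : m < (freeIndices σ).card) :
    ¬ ((partitionComplex a p m).linkWithin σ (↑σ)ᶜ).AcyclicAt K ((freeIndices σ).card - 2) := by
  set n := (freeIndices σ).card with hn'
  set X : Finset (PartitionVertex a p) := (freeIndices σ).image x with hX
  have hXcard : X.card = n := Finset.card_image_of_injective _ fun r s h => x.inj h
  have hσf' := ((mem_partitionComplex ha hm hmp).1 hσf).1
  have hXσ : ↑X ⊆ (↑σ : Set (PartitionVertex a p))ᶜ := by
    intro v hv
    obtain ⟨r, hr, rfl⟩ := Finset.mem_image.1 (Finset.mem_coe.1 hv)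
    exact (mem_freeIndices.1 hr).2
  have hyX : ySupport (σ ∪ X) = ∅ := by
    rw [ySupport_union, hσ, Finset.empty_union]
    ext r
    simp [mem_ySupport, hX]
  have hXf : σ ∪ X ∈ (extendedPartitionComplex a p m).faces := by
    refine ⟨fun r _ => by simp [hyX], by simp [hyX], ?_⟩
    rw [cost, Finset.sum_eq_zero fun r _ => yHeight_eq_zero (by simp [hyX])]
    exact Nat.zero_le _
  have hXn : X ∉ ((partitionComplex a p m).linkWithin σ (↑σ)ᶜ).faces := by
    rintro ⟨-, h⟩
    obtain ⟨r, hr⟩ := ((mem_partitionComplex ha hm hmp).1 h).2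
    rw [Finset.mem_union, not_or] at hr
    exact hr.2 (Finset.mem_image_of_mem _ (mem_freeIndices.2 ⟨by simp [hσ], hr.1⟩))
  have hchain : Finsupp.single X (1 : K) ∈
      ((extendedPartitionComplex a p m).linkWithin σ (↑σ)ᶜ).chains K (n - 1) :=
    Finsupp.single_mem_supported K _ ⟨⟨hXσ, hXf⟩, by rw [hXcard]; ring⟩
  intro hacyc
  have hz : boundaryMap K (Finsupp.single X 1) ∈
      ((partitionComplex a p m).linkWithin σ (↑σ)ᶜ).cycles K (n - 2) := by
    refine ⟨boundaryMap_mem_supported K (s := {X}) (Finsupp.single_mem_supported K _ rfl) ?_,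
      boundaryMap_boundaryMap K _⟩
    rintro _ rfl v hv
    have hXv := hv
    obtain ⟨r, hr, rfl⟩ := Finset.mem_image.1 hv
    refine ⟨⟨(Finset.coe_subset.2 (Finset.erase_subset _ _)).trans hXσ, ?_⟩, ?_⟩
    · rw [mem_partitionComplex ha hm hmp]
      refine ⟨FaceComplex.down_closed _ hXf
        (Finset.union_subset_union_right (Finset.erase_subset _ _)), r, ?_⟩
      simp [(mem_freeIndices.1 hr).2]
    · have := Finset.card_erase_add_one hXv
      omega
  obtain ⟨c, hc, hcz⟩ := hacyc hz
  have hn1 : (n : ℤ) - 2 + 1 = n - 1 := by ring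
  rw [hn1] at hc
  have hc' : c ∈ ((extendedPartitionComplex a p m).linkWithin σ (↑σ)ᶜ).chains K (n - 1) :=
    (chains_mono fun τ hτ _ => ⟨hτ.1, ((mem_partitionComplex ha hm hmp).1 hτ.2).1⟩ :
      ((partitionComplex a p m).linkWithin σ (↑σ)ᶜ).chains K (n - 1) ≤
        ((extendedPartitionComplex a p m).linkWithin σ (↑σ)ᶜ).chains K (n - 1)) hc
  obtain ⟨d, hd, hdz⟩ := acyclicAt_extended_of_isInitial (K := K) (j := n - 1) ha hσf'
    (isInitial_of_ySupport_eq_empty hσ) (Or.inl (by omega))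
    (show Finsupp.single X 1 - c ∈ _ from ⟨Submodule.sub_mem _ hchain hc', by
      change boundaryMap K (Finsupp.single X 1 - c) = 0
      rw [map_sub, hcz, sub_self]⟩)
  have hdX : boundaryMap K d ∈ Finsupp.supported K K {τ : Finset (PartitionVertex a p) | τ ≠ X} := by
    refine boundaryMap_mem_supported K hd ?_
    rintro τ ⟨⟨hτσ, hτf⟩, hτc⟩ v hv hvX
    have hsub : X ⊆ τ := hvX ▸ Finset.erase_subset v τ
    have hτX : τ = X := eq_image_of_forall_x_mem hσ hτσ hτf fun r hr =>
      hsub (Finset.mem_image_of_mem _ hr)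
    rw [hτX, hXcard] at hτc
    omega
  rw [hdz] at hdX
  have h0 : (Finsupp.single X (1 : K) - c : Finset (PartitionVertex a p) →₀ K) X = 0 := by
    by_contra h0
    exact hdX (Finsupp.mem_support_iff.2 h0) rfl
  have hcX : c X = 0 := by
    by_contra h0
    exact hXn (hc (Finsupp.mem_support_iff.2 h0)).1
  simp [hcX] at h0

lemma not_acyclicAt_of_forall_card_le {V : Type*} [LinearOrder V] {Δ : FaceComplex V} {i : ℤ}
    (hΔ : ∀ σ ∈ Δ.faces, (σ.card : ℤ) ≤ i + 1) {z : Finset V →₀ K} (hz : z ∈ Δ.cycles K i)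
    (hz0 : z ≠ 0) : ¬ Δ.AcyclicAt K i := by
  intro h
  obtain ⟨c, hc, rfl⟩ := h hz
  refine hz0 ?_
  change c ∈ Finsupp.supported K K _ at hc
  rw [Set.eq_empty_of_forall_notMem (s := {σ | σ ∈ Δ.faces ∧ (σ.card : ℤ) = i + 1 + 1})
    fun σ hσ => by have := hΔ σ hσ.1; have := hσ.2; omega, Finsupp.supported_empty] at hc
  rw [(Submodule.mem_bot K).1 hc, map_zero]

/-- The facets of the cross-polytope with the pairs of opposite vertices `x r`, `y r o` for
`r ∈ Z`. -/
def crossPolytopeFacets (o : Fin (a - 1)) (Z : Finset (Fin (p + 1))) :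
    Set (Finset (PartitionVertex a p)) :=
  {τ | τ.card = Z.card ∧ (∀ v ∈ τ, idx v ∈ Z ∧ (v = x (idx v) ∨ v = y (idx v) o)) ∧
    ∀ r, x r ∈ τ → y r o ∉ τ}

lemma insert_mem_crossPolytopeFacets {o : Fin (a - 1)} {Z : Finset (Fin (p + 1))}
    {τ : Finset (PartitionVertex a p)} {v : PartitionVertex a p}
    (hτ : τ ∈ crossPolytopeFacets o Z) (hv : v = x (idx v) ∨ v = y (idx v) o) (hvZ : idx v ∉ Z) :
    insert v τ ∈ crossPolytopeFacets o (insert (idx v) Z) := by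
  obtain ⟨h1, h2, h3⟩ := hτ
  have hvτ : ∀ w ∈ τ, idx w ≠ idx v := fun w hw h => hvZ (h ▸ (h2 w hw).1)
  refine ⟨?_, ?_, ?_⟩
  · rw [Finset.card_insert_of_notMem fun h => hvτ v h rfl, Finset.card_insert_of_notMem hvZ, h1]
  · intro w hw
    rcases Finset.mem_insert.1 hw with rfl | hw
    · exact ⟨Finset.mem_insert_self _ _, hv⟩
    · exact ⟨Finset.mem_insert_of_mem (h2 w hw).1, (h2 w hw).2⟩
  · intro r hx hy
    rcases Finset.mem_insert.1 hx with hx | hx <;> rcases Finset.mem_insert.1 hy with hy | hy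
    · rw [← hy] at hx
      cases hx
    · exact hvτ _ hy (by rw [← hx]; rfl)
    · exact hvτ _ hx (by rw [← hy]; rfl)
    · exact h3 r hx hy

/-- The fundamental cycle of the cross-polytope. -/
lemma exists_crossPolytope_cycle (o : Fin (a - 1)) (Z : Finset (Fin (p + 1))) :
    ∃ c ∈ Finsupp.supported K K (crossPolytopeFacets o Z), boundaryMap K c = 0 ∧ c ≠ 0 := by
  induction Z using Finset.induction_on with
  | empty =>
    refine ⟨Finsupp.single ∅ 1, Finsupp.single_mem_supported K _ ?_, ?_, by simp⟩
    · simp [crossPolytopeFacets]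
    · simp [boundaryMap_single]
  | insert z Z hz ih =>
    obtain ⟨c, hc, hc0, hcne⟩ := ih
    have hx : coneMap K (x z) c ∈ Finsupp.supported K K
        {τ | τ ∈ crossPolytopeFacets o (insert z Z) ∧ x z ∈ τ} :=
      coneMap_mem_supported K hc fun τ hτ _ =>
        ⟨insert_mem_crossPolytopeFacets (v := x z) hτ (Or.inl rfl) hz, Finset.mem_insert_self _ _⟩
    have hy : coneMap K (y z o) c ∈ Finsupp.supported K K
        {τ | τ ∈ crossPolytopeFacets o (insert z Z) ∧ y z o ∈ τ} :=
      coneMap_mem_supported K hc fun τ hτ _ =>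
        ⟨insert_mem_crossPolytopeFacets (v := y z o) hτ (Or.inr rfl) hz, Finset.mem_insert_self _ _⟩
    have hbx := boundaryMap_coneMap K (x z) c
    have hby := boundaryMap_coneMap K (y z o) c
    rw [hc0, map_zero, add_zero] at hbx hby
    -- The suspension of `c`. It is nonzero because the two cones have disjoint supports, so
    -- equality would make both vanish.
    refine ⟨coneMap K (y z o) c - coneMap K (x z) c, Submodule.sub_mem _
      (Finsupp.supported_mono (fun τ h => h.1) hy) (Finsupp.supported_mono (fun τ h => h.1) hx),
      by rw [map_sub, hbx, hby, sub_self], fun h => hcne ?_⟩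
    rw [sub_eq_zero] at h
    have h0 : coneMap K (x z) c = 0 := by
      rw [← Finsupp.support_eq_empty, Finset.eq_empty_iff_forall_notMem]
      intro τ hτ
      have h1 := hx hτ
      rw [← h] at hτ
      exact h1.1.2.2 z h1.2 (hy hτ).2
    rw [← hbx, h0, map_zero]

lemma hasLinkHomology_of_le (ha : 2 ≤ a) (hm : 1 ≤ m) (hmp : m ≤ p) {i : ℕ} (hi : m ≤ i)
    (hip : i ≤ p) : (partitionComplex a p m).HasLinkHomology K ((i : ℤ) - 1) (p - i) := by
  -- Rows `0, …, i` are left free, so the sphere of dimension `(i + 1) - 2` appears.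
  set σ : Finset (PartitionVertex a p) :=
    (Finset.univ.filter fun r : Fin (p + 1) => i < r.val).image x with hσ
  have hx : ∀ r, x r ∈ σ ↔ i < r.val := fun r => by simp [hσ]
  have hy : ySupport σ = ∅ := by
    ext r
    simp [mem_ySupport, hσ]
  have hcost : cost σ = 0 := Finset.sum_eq_zero fun r _ => yHeight_eq_zero (by simp [hy])
  have hface : σ ∈ (partitionComplex a p m).faces := by
    rw [mem_partitionComplex ha hm hmp]
    refine ⟨⟨fun r _ => by simp [hy], by simp [hy], by simp [hcost]⟩, 0, ?_⟩
    simp [hx]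
  have hfree : (freeIndices σ).card = i + 1 := by
    have : freeIndices σ = Finset.Iic (⟨i, by omega⟩ : Fin (p + 1)) := by
      ext r
      simp [mem_freeIndices, hy, hx, Fin.le_def]
    rw [this, Fin.card_Iic]
  have hcard := card_add_card_freeIndices ha (F := σ) (fun r _ => by simp [hy])
    (isInitial_of_ySupport_eq_empty hy)
  refine ⟨σ, hface, by omega, ?_⟩
  rw [nontrivial_reducedHomology_iff_not_acyclicAt, link_eq_linkWithin]
  have := not_acyclicAt_of_ySupport_eq_empty K ha hm hmp hface hy (by omega)
  rw [hfree] at this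
  have hi2 : (i : ℤ) - 1 = ((i + 1 : ℕ) : ℤ) - 2 := by omega
  rwa [hi2]

lemma hasLinkHomology_of_lt (ha : 2 ≤ a) (hm : 1 ≤ m) (hmp : m ≤ p) {i : ℕ} (hi : i < m) :
    (partitionComplex a p m).HasLinkHomology K ((i : ℤ) - 1) (p + a - 1 - i) := by
  let o : Fin (a - 1) := ⟨0, by omega⟩
  set σ : Finset (PartitionVertex a p) :=
    (Finset.univ.filter fun r : Fin (p + 1) => i < r.val).image x ∪ Finset.univ.image (y 0)
    with hσ
  have hx : ∀ r, x r ∈ σ ↔ i < r.val := fun r => by simp [hσ]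
  have hy : ∀ r j, y r j ∈ σ ↔ r = 0 := fun r j => by simp [hσ, eq_comm]
  have hs : ySupport σ = {0} := by
    ext r
    simp only [mem_ySupport, hy, Finset.mem_singleton]
    exact ⟨fun ⟨_, h⟩ => h, fun h => ⟨o, h⟩⟩
  have hh : ∀ r, r ≠ 0 → yHeight σ r = 0 := fun r hr => yHeight_eq_zero (by simpa [hs] using hr)
  have hcost : cost σ = a - 2 := by
    rw [cost, Finset.sum_eq_single_of_mem 0 (Finset.mem_univ _) fun r _ hr => hh r hr]
    refine le_antisymm (yHeight_le fun j _ => by omega) ?_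
    exact le_yHeight (j := ⟨a - 2, by omega⟩) ((hy _ _).2 rfl)
  have hinit : IsInitial σ := fun r hr j _ => (hy r j).2 (by simpa [hs] using hr)
  have hxs : ∀ r, x r ∈ σ → r ∉ ySupport σ := fun r hr hr' => by
    rw [hs, Finset.mem_singleton] at hr'
    rw [hx, hr'] at hr
    simp at hr
  have hface' : σ ∈ (extendedPartitionComplex a p m).faces :=
    ⟨hxs, by simpa [hs] using hm, hcost.le⟩
  have hface : σ ∈ (partitionComplex a p m).faces := by
    rw [mem_partitionComplex ha hm hmp]
    exact ⟨hface', 0, by simp [hx]⟩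
  have hfree : freeIndices σ = Finset.Ioc 0 (⟨i, by omega⟩ : Fin (p + 1)) := by
    ext r
    simp only [mem_freeIndices, hs, Finset.mem_singleton, hx, Finset.mem_Ioc, Fin.le_def,
      Fin.lt_def, Fin.ext_iff, Fin.val_zero]
    omega
  have hfc : (freeIndices σ).card = i := by
    rw [hfree, Fin.card_Ioc]
    simp
  have hcard := card_add_card_freeIndices ha hxs hinit
  refine ⟨σ, hface, by omega, ?_⟩
  rw [nontrivial_reducedHomology_iff_not_acyclicAt, link_eq_linkWithin,
    linkWithin_partitionComplex_eq_extended ha hm hmp (by simp [hs])]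
  obtain ⟨c, hc, hc0, hcne⟩ := exists_crossPolytope_cycle K o (freeIndices σ)
  -- The fundamental cycle lies in the top dimension, so nothing can bound it.
  refine not_acyclicAt_of_forall_card_le K ?_ ⟨?_, hc0⟩ hcne
  · rintro τ ⟨hτσ, hτf⟩
    have hsupp : ySupport τ ⊆ freeIndices σ := fun r hr => by
      obtain ⟨j, hj⟩ := mem_ySupport.1 hr
      refine mem_freeIndices.2 ⟨?_, fun hxr => hτf.1 r (Finset.mem_union_left _ hxr)
        (mem_ySupport_of_mem (Finset.mem_union_right _ hj))⟩
      rw [hs, Finset.mem_singleton]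
      exact fun h => hτσ hj ((hy r j).2 h)
    have hxτ : ∀ r, x r ∈ τ → r ∈ freeIndices σ := fun r hr => by
      refine mem_freeIndices.2 ⟨fun h => ?_, hτσ hr⟩
      exact hτf.1 r (Finset.mem_union_right _ hr) (ySupport_mono Finset.subset_union_left h)
    have hzero : ∀ r j, y r j ∈ τ → j = o := fun r j hj => by
      have hr := hsupp (mem_ySupport_of_mem hj)
      have hr0 : r ≠ 0 := fun h => (mem_freeIndices.1 hr).1 (by simp [hs, h])
      have h1 := hτf.2.2
      rw [cost, ← Finset.add_sum_erase _ _ (Finset.mem_univ (0 : Fin (p + 1)))] at h1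
      have h2 : cost σ = yHeight σ 0 := by
        rw [cost, Finset.sum_eq_single_of_mem 0 (Finset.mem_univ _) fun r _ hr => hh r hr]
      have h3 : yHeight σ 0 ≤ yHeight (σ ∪ τ) 0 := yHeight_mono Finset.subset_union_left 0
      have h4 : yHeight (σ ∪ τ) r ≤ ∑ s ∈ Finset.univ.erase 0, yHeight (σ ∪ τ) s :=
        Finset.single_le_sum (f := yHeight (σ ∪ τ)) (fun _ _ => Nat.zero_le _)
          (Finset.mem_erase.2 ⟨hr0, Finset.mem_univ r⟩)
      have h5 := le_yHeight (Finset.mem_union_right σ hj)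
      exact Fin.ext (by change j.val = 0; omega)
    have : τ.card ≤ (freeIndices σ).card := by
      refine Finset.card_le_card_of_injOn idx ?_ ?_
      · intro v hv
        cases v with
        | x r => exact hxτ r hv
        | y r j => exact hsupp (mem_ySupport_of_mem hv)
      · have hne : ∀ r j, x r ∈ τ → y r j ∉ τ := fun r j h1 h2 =>
          hτf.1 r (Finset.mem_union_right _ h1) (mem_ySupport_of_mem (Finset.mem_union_right _ h2))
        intro v hv w hw hvw
        cases v with
        | x r =>
          cases w with
          | x s => exact congrArg x hvw
          | y s k => exact (hne s k ((show r = s from hvw) ▸ hv) hw).elim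
        | y r j =>
          cases w with
          | x s => exact (hne r j ((show r = s from hvw) ▸ hw) hv).elim
          | y s k =>
            rw [hzero r j hv, hzero s k hw]
            exact congrArg (y · o) hvw
    omega
  · refine Finsupp.supported_mono ?_ hc
    rintro τ ⟨h1, h2, h3⟩
    have hyτ : ∀ r j, y r j ∈ τ → j = o := fun r j hj => by
      rcases (h2 _ hj).2 with h | h
      · cases h
      · exact (y.inj h).2
    have hsupp : ySupport τ ⊆ freeIndices σ := fun r hr => by
      obtain ⟨j, hj⟩ := mem_ySupport.1 hr
      exact (h2 _ hj).1
    refine ⟨⟨fun v hv hvσ => ?_, fun r hr hr' => ?_, ?_, ?_⟩, by omega⟩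
    · have hv' := mem_freeIndices.1 (h2 v hv).1
      rcases (h2 v hv).2 with h | h
      · exact hv'.2 (h ▸ hvσ)
      · rw [Finset.mem_coe, h] at hvσ
        exact hv'.1 (mem_ySupport_of_mem hvσ)
    · rw [ySupport_union, Finset.mem_union] at hr'
      rcases Finset.mem_union.1 hr with hr | hr
      · rcases hr' with h | h
        · exact hxs r hr h
        · exact (mem_freeIndices.1 (hsupp h)).2 hr
      · rcases hr' with h | h
        · exact (mem_freeIndices.1 (h2 _ hr).1).1 h
        · obtain ⟨j, hj⟩ := mem_ySupport.1 h
          exact h3 r hr (hyτ r j hj ▸ hj)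
    · rw [ySupport_union]
      refine (Finset.card_union_le _ _).trans ?_
      have := Finset.card_le_card hsupp
      rw [hs, Finset.card_singleton]
      omega
    · rw [cost, Finset.sum_eq_single_of_mem 0 (Finset.mem_univ _)]
      · exact yHeight_le fun j _ => by omega
      · intro r _ hr
        refine Nat.le_zero.1 (yHeight_le fun j hj => ?_)
        rcases Finset.mem_union.1 hj with h | h
        · exact (hr ((hy r j).1 h)).elim
        · rw [hyτ r j h]

end Nonvanishing

/-! ### Assembly of the degree type -/

theorem mainTheorem3 (K : Type*) [Field K] (a p m : ℕ) (ha : 2 ≤ a) (hm : 1 ≤ m) (hmp : m ≤ p) :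
    (partitionComplex a p m).IsPR K ∧
    (partitionComplex a p m).HasDegreeType K
      (List.replicate (p - m) 1 ++ a :: List.replicate (m - 1) 1) := by
  have hPR : (partitionComplex a p m).IsPR K := by
    intro i σ hσ τ hτ h h'
    have h1 := card_of_nontrivial_reducedHomology_link ha hm hmp hσ h
    have h2 := card_of_nontrivial_reducedHomology_link ha hm hmp hτ h'
    omega
  have hlen : (List.replicate (p - m) 1 ++ a :: List.replicate (m - 1) 1).length = p := by
    simp
    omega
  refine ⟨hPR, hPR, ?_, fun i => if m ≤ i then p - i else p + a - 1 - i, fun i hi => ?_,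
    fun i hi1 hi => ?_⟩
  · rw [hlen]
    refine ⟨⟨_, hasLinkHomology_of_le K ha hm hmp hmp le_rfl⟩, ?_⟩
    rintro k ⟨n, σ, hσ, -, h⟩
    have := card_of_nontrivial_reducedHomology_link ha hm hmp hσ h
    omega
  · rw [hlen] at hi
    beta_reduce
    split_ifs with h
    · exact hasLinkHomology_of_le K ha hm hmp h hi
    · exact hasLinkHomology_of_lt K ha hm hmp (not_le.1 h)
  · simp only [hlen] at hi ⊢
    -- Only at `i = m` do `s (i - 1)` and `s i` come from different families, giving `(p + a - m) -
    -- (p - m) = a`.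
    rcases lt_trichotomy i m with h | rfl | h
    · rw [List.getElem_append_right (by simp; omega), List.getElem_cons]
      rw [dif_neg (by simp; omega), List.getElem_replicate, if_neg (by omega), if_neg (by omega)]
      omega
    · rw [List.getElem_append_right (by simp), List.getElem_cons, dif_pos (by simp),
        if_neg (by omega), if_pos le_rfl]
      omega
    · rw [List.getElem_append_left (by simp; omega), List.getElem_replicate, if_pos (by omega),
        if_pos (by omega)]
      omega
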